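/- Let $0<\alpha\le 1$ and $\nu\in\mathbb R$, with $\nu\ge 0$ if $\alpha=1$. Let $D\subset\mathbb C$ be a bounded domain with $C^{1,\alpha}$ boundary, i.e. $\partial D$ is the union of finitely many pairwise disjoint $C^{1,\alpha}$ Jordan curves (with regular parametrizations), oriented so that $D$ lies to their left. For real $\beta$ let $C^{L^\alpha Log^\beta L}(D)$ be the space of continuous functions $f:D\to\mathbb C$ with $$\|f\|_{C^{L^\alpha Log^\beta L}(D)}:=\sup_{w\in D}|f(w)|+\sup_{\substack{w,\,w+h\in D\\ 0<|h|\le 1/2}}\frac{|f(w+h)-f(w)|}{|h|^\alpha\,|\ln|h||^{\beta}}<\infty .$$ Such an $f$ extends continuously to $\overline D$; with this extension again denoted by $f$, put $$Sf(z):=\frac1{2\pi i}\int_{\partial D}\frac{f(\zeta)}{\zeta-z}\,d\zeta,\qquad z\in D.$$ Then there is a constant $C$ depending only on $D$, $\alpha$ and $\nu$ such that the following hold. If $0<\alpha<1$, then $S$ maps $C^{L^\alpha Log^\nu L}(D)$ into itself, and for all $f\in C^{L^\alpha Log^\nu L}(D)$ $$\|Sf\|_{C^{L^\alpha Log^\nu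 L}(D)}\le C\,\|f\|_{C^{L^\alpha Log^\nu L}(D)}.$$ If $\alpha=1$, then $S$ maps $C^{L^1 Log^\nu L}(D)$ into $C^{L^1 Log^{\nu+1} L}(D)$, and for all $f\in C^{L^1 Log^\nu L}(D)$ $$\|Sf\|_{C^{L^1 Log^{\nu+1} L}(D)}\le C\,\|f\|_{C^{L^1 Log^\nu L}(D)}.$$ -/

import Mathlib

open scoped ENNReal NNReal Topology

/-- The Log-Hölder norm `‖f‖_{C^{L^α Log^ν L}(D)}` with values in `[0, ∞]`: the supremum of `|f|`
over `D` plus the supremum of `|f(w + h) - f(w)| / (|h|^α |ln |h||^ν)` over all `w, w + h ∈ D` with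
`0 < |h| ≤ 1/2`; here `w' = w + h`. Only the values of `f` on `D` enter. -/
noncomputable def logHolderNorm (α ν : ℝ) (D : Set ℂ) (f : ℂ → ℂ) : ℝ≥0∞ :=
  (⨆ w ∈ D, ENNReal.ofReal ‖f w‖) +
    ⨆ w ∈ D, ⨆ w' ∈ D, ⨆ (_ : 0 < ‖w' - w‖ ∧ ‖w' - w‖ ≤ 1 / 2),
      ENNReal.ofReal (‖f w' - f w‖ / (‖w' - w‖ ^ α * |Real.log ‖w' - w‖| ^ ν))

/-- Membership in the Log-Hölder space `C^{L^α Log^ν L}(D)`. -/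
def MemLogHolder (α ν : ℝ) (D : Set ℂ) (f : ℂ → ℂ) : Prop :=
  ContinuousOn f D ∧ logHolderNorm α ν D f < ∞

/-- The finite family `γ` of closed curves, each with period `1`, is a positively oriented `C^{1,α}`
parametrization of the boundary of `D`: the curves are regular `C^{1,α}` Jordan curves without
common points, their union is `∂D`, and `D` lies to the left of each of them. A bounded domain has
`C^{1,α}` boundary when such a family exists. -/
structure IsC1HolderBoundary (α : ℝ) (D : Set ℂ) {N : ℕ} (γ : Fin N → ℝ → ℂ) : Prop where
  contDiff : ∀ j, ContDiff ℝ 1 (γ j)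
  holder_deriv : ∀ j, ∃ K : ℝ, ∀ s t : ℝ, ‖deriv (γ j) s - deriv (γ j) t‖ ≤ K * |s - t| ^ α
  deriv_ne_zero : ∀ j t, deriv (γ j) t ≠ 0
  periodic : ∀ j, Function.Periodic (γ j) 1
  injOn : ∀ j, Set.InjOn (γ j) (Set.Ico 0 1)
  pairwise_disjoint : ∀ j k, j ≠ k → Disjoint (Set.range (γ j)) (Set.range (γ k))
  frontier_eq : frontier D = ⋃ j, Set.range (γ j)
  left_mem : ∀ j t, ∀ᶠ ε : ℝ in 𝓝[>] 0, γ j t + (ε : ℂ) * (Complex.I * deriv (γ j) t) ∈ D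

/-- The Cauchy integral `S f (z) = (2πi)⁻¹ ∫_{∂D} f(ζ) / (ζ - z) dζ`, where `∂D` is parametrized by
the closed curves `γ j` of period `1`. A function `f` in a Log-Hölder space on `D` is uniformly
continuous on `D`; its values on `∂D` are those of its continuous extension to the closure. -/
noncomputable def cauchyS (D : Set ℂ) {N : ℕ} (γ : Fin N → ℝ → ℂ) (f : ℂ → ℂ) (z : ℂ) : ℂ :=
  (2 * (Real.pi : ℂ) * Complex.I)⁻¹ *
    ∑ j, ∫ t in (0 : ℝ)..1, extendFrom D f (γ j t) / (γ j t - z) * deriv (γ j) t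

/-!
The Cauchy integral `F = Sf` is estimated through its derivative. Write `δ` for the distance of `z`
to `∂D` and `Ω(r) = r ^ α (1 + max 0 (-log r)) ^ ν` (`logGauge`), a modulus equivalent to the one in
the norm. Since `dζ / (ζ - z)²` has a primitive along closed curves,
`2πi F'(z) = ∫ (f(ζ) - f(z)) / (ζ - z)² dζ`, and therefore `|F'(z)| ≤ ‖f‖ ∫ Ω(|ζ - z|) / |ζ - z|² |dζ|`.
Arc length gives a ball of radius `r` mass at most `A r`, so a decomposition into dyadic annuli
bounds this by `Ω(δ) / δ` when `α < 1` (a geometric series, `dyadicSumBound_of_lt_one`). When `α = 1`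
all annuli contribute equally, and their number, of order `|log δ|`, accounts for the additional
logarithm (`dyadicSumBound_one`).

The gradient bound is integrated along paths that leave the boundary along the axis of a cone inside
`D`, cross at a height comparable to the distance of the two points, and come back
(`exists_modulus_of_gradientBound`). This needs an interior cone condition that is uniform along
`∂D` (`IsC1HolderBoundary.exists_uniformConeCondition`). Locally `∂D` is a Lipschitz graph, and the
point is that `D` lies on one side of it only: the winding integral of a boundary curve is constant
on the connected set `D`, but it jumps by `2πi` across the curve (`tendsto_windingIntegral_jump`).

The constant may depend on `D` but not on the parametrization of `∂D`. The geometric constants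
belong to `D` itself, and the arc length of any parametrization is at most twice the one-dimensional
Hausdorff measure on `∂D` (`IsC1HolderBoundary.arcLengthMeasure_le`), whose growth is estimated once
with a fixed parametrization.
-/

/-! ### The logarithmic gauge -/

/-- The gauge `r ^ α * ℓ(r) ^ ν` with `ℓ(r) = 1 + max 0 (-log r)`. For `0 < r ≤ 1/2` it is comparable
to `r ^ α * |log r| ^ ν`; unlike the latter it is positive and tame at all `r > 0`, in particular
at `r = 1`. -/
noncomputable def logGauge (α ν r : ℝ) : ℝ := r ^ α * (1 + max 0 (-Real.log r)) ^ ν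

lemma one_le_one_add_max_neg_log (r : ℝ) : 1 ≤ 1 + max 0 (-Real.log r) := by
  have := le_max_left 0 (-Real.log r)
  linarith

lemma logGauge_pos (α ν : ℝ) {r : ℝ} (hr : 0 < r) : 0 < logGauge α ν r := by
  have := one_le_one_add_max_neg_log r
  unfold logGauge
  positivity

/-- Comparability of two numbers up to a factor `c` passes to `ν`-th powers with factor
`c ^ |ν|`, whatever the sign of `ν`. -/
lemma rpow_le_rpow_abs_mul {x y c : ℝ} (ν : ℝ) (hx : 0 < x) (hc : 1 ≤ c)
    (hxy : x ≤ c * y) (hyx : y ≤ c * x) : x ^ ν ≤ c ^ |ν| * y ^ ν := by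
  have hc0 : 0 < c := by linarith
  have hy : 0 < y := by
    by_contra h
    nlinarith [mul_nonneg hc0.le (by linarith : 0 ≤ -y)]
  rcases le_total 0 ν with h | h
  · rw [abs_of_nonneg h, ← Real.mul_rpow hc0.le hy.le]
    exact Real.rpow_le_rpow hx.le hxy h
  · rw [abs_of_nonpos h, Real.rpow_neg hc0.le, ← Real.inv_rpow hc0.le,
      ← Real.mul_rpow (by positivity) hy.le]
    refine Real.rpow_le_rpow_of_nonpos (by positivity) ?_ h
    rw [inv_mul_le_iff₀ hc0]
    exact hyx

lemma max_neg_log_mul {r l : ℝ} (hr : 0 < r) (hl : 1 ≤ l) :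
    1 + max 0 (-Real.log (l * r)) ≤ 1 + max 0 (-Real.log r) ∧
      1 + max 0 (-Real.log r) ≤ (1 + Real.log l) * (1 + max 0 (-Real.log (l * r))) := by
  have h0 := Real.log_nonneg hl
  rw [Real.log_mul (by positivity) hr.ne']
  constructor
  · gcongr
    linarith
  · have h1 := le_max_left 0 (-(Real.log l + Real.log r))
    have h2 := le_max_right 0 (-(Real.log l + Real.log r))
    have : max 0 (-Real.log r) ≤ Real.log l + max 0 (-(Real.log l + Real.log r)) :=
      max_le (by linarith) (by linarith)
    nlinarith [mul_nonneg h0 h1]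

/-- Rescaling by `l ≥ 1` changes `logGauge α ν` like `l ^ α`, up to a power of `1 + log l`. -/
lemma logGauge_mul_le (α ν : ℝ) {r l : ℝ} (hr : 0 < r) (hl : 1 ≤ l) :
    logGauge α ν (l * r) ≤ l ^ α * (1 + Real.log l) ^ |ν| * logGauge α ν r := by
  obtain ⟨h1, h2⟩ := max_neg_log_mul hr hl
  have h0 := Real.log_nonneg hl
  have h3 := one_le_one_add_max_neg_log r
  have h4 := one_le_one_add_max_neg_log (l * r)
  have h5 := rpow_le_rpow_abs_mul ν (x := 1 + max 0 (-Real.log (l * r)))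
    (y := 1 + max 0 (-Real.log r)) (c := 1 + Real.log l) (by linarith) (by linarith)
    (by nlinarith) h2
  unfold logGauge
  rw [Real.mul_rpow (by linarith) hr.le]
  calc _ ≤ l ^ α * r ^ α * ((1 + Real.log l) ^ |ν| * (1 + max 0 (-Real.log r)) ^ ν) := by gcongr
    _ = _ := by ring

lemma logGauge_le_mul (α ν : ℝ) {r l : ℝ} (hr : 0 < r) (hl : 1 ≤ l) :
    logGauge α ν r ≤ l ^ (-α) * (1 + Real.log l) ^ |ν| * logGauge α ν (l * r) := by
  obtain ⟨h1, h2⟩ := max_neg_log_mul hr hl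
  have h0 := Real.log_nonneg hl
  have h3 := one_le_one_add_max_neg_log r
  have h4 := one_le_one_add_max_neg_log (l * r)
  have h5 := rpow_le_rpow_abs_mul ν (y := 1 + max 0 (-Real.log (l * r)))
    (x := 1 + max 0 (-Real.log r)) (c := 1 + Real.log l) (by linarith) (by linarith)
    h2 (by nlinarith)
  have hl0 : 0 < l := by linarith
  unfold logGauge
  rw [Real.mul_rpow (by linarith) hr.le, Real.rpow_neg hl0.le]
  calc _ ≤ r ^ α * ((1 + Real.log l) ^ |ν| * (1 + max 0 (-Real.log (l * r))) ^ ν) := by gcongr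
    _ = _ := by
      have : l ^ α ≠ 0 := by positivity
      field_simp

/-- Powers of the logarithm are absorbed by any positive power. -/
lemma exists_one_add_log_rpow_le (β : ℝ) {ε : ℝ} (hβ : 0 ≤ β) (hε : 0 < ε) :
    ∃ K : ℝ, 0 < K ∧ ∀ l : ℝ, 1 ≤ l → (1 + Real.log l) ^ β ≤ K * l ^ ε := by
  have hδ : 0 < ε / (β + 1) := by positivity
  refine ⟨(1 + (ε / (β + 1))⁻¹) ^ β, by positivity, fun l hl => ?_⟩
  have hl0 : 0 < l := by linarith
  have h0 := Real.log_nonneg hl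
  have h1 : 1 + Real.log l ≤ (1 + (ε / (β + 1))⁻¹) * l ^ (ε / (β + 1)) := by
    have h2 := Real.log_le_rpow_div hl0.le hδ
    have h3 : 1 ≤ l ^ (ε / (β + 1)) := Real.one_le_rpow hl hδ.le
    rw [div_eq_mul_inv _ (ε / (β + 1))] at h2
    linarith
  calc (1 + Real.log l) ^ β ≤ ((1 + (ε / (β + 1))⁻¹) * l ^ (ε / (β + 1))) ^ β := by gcongr
    _ = (1 + (ε / (β + 1))⁻¹) ^ β * l ^ (ε / (β + 1) * β) := by
      rw [Real.mul_rpow (by positivity) (by positivity), ← Real.rpow_mul hl0.le]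
    _ ≤ _ := by
      gcongr
      · rw [div_mul_eq_mul_div, div_le_iff₀ (by positivity)]
        nlinarith

lemma exists_logGauge_mul_le {α b : ℝ} (ν : ℝ) (hb : α < b) :
    ∃ K : ℝ, 0 < K ∧ ∀ r l : ℝ, 0 < r → 1 ≤ l →
      logGauge α ν (l * r) ≤ K * l ^ b * logGauge α ν r := by
  obtain ⟨K, hK, h⟩ := exists_one_add_log_rpow_le |ν| (abs_nonneg ν) (sub_pos.2 hb)
  refine ⟨K, hK, fun r l hr hl => (logGauge_mul_le α ν hr hl).trans ?_⟩
  have hl0 : 0 < l := by linarith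
  have := (logGauge_pos α ν hr).le
  refine mul_le_mul_of_nonneg_right ?_ this
  calc l ^ α * (1 + Real.log l) ^ |ν| ≤ l ^ α * (K * l ^ (b - α)) := by gcongr; exact h l hl
    _ = K * l ^ b := by
      rw [mul_left_comm, ← Real.rpow_add hl0]
      ring_nf

lemma exists_logGauge_le_mul {α a : ℝ} (ν : ℝ) (ha : a < α) :
    ∃ K : ℝ, 0 < K ∧ ∀ r l : ℝ, 0 < r → 1 ≤ l →
      logGauge α ν r ≤ K * l ^ (-a) * logGauge α ν (l * r) := by
  obtain ⟨K, hK, h⟩ := exists_one_add_log_rpow_le |ν| (abs_nonneg ν) (sub_pos.2 ha)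
  refine ⟨K, hK, fun r l hr hl => (logGauge_le_mul α ν hr hl).trans ?_⟩
  have hl0 : 0 < l := by linarith
  have := (logGauge_pos α ν (mul_pos hl0 hr)).le
  refine mul_le_mul_of_nonneg_right ?_ this
  calc l ^ (-α) * (1 + Real.log l) ^ |ν| ≤ l ^ (-α) * (K * l ^ (α - a)) := by gcongr; exact h l hl
    _ = K * l ^ (-a) := by
      rw [mul_left_comm, ← Real.rpow_add hl0]
      ring_nf

lemma logGauge_one_mul_le {ν r l : ℝ} (hν : 0 ≤ ν) (hr : 0 < r) (hl : 1 ≤ l) :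
    logGauge 1 ν (l * r) ≤ l * logGauge 1 ν r := by
  have h1 := (max_neg_log_mul hr hl).1
  have h4 := one_le_one_add_max_neg_log (l * r)
  unfold logGauge
  rw [Real.rpow_one, Real.rpow_one, mul_assoc]
  gcongr

/-- For `0 < h ≤ 1/2`, the numbers `|log h|` and `1 + max 0 (-log h)` agree up to a factor `3`. -/
lemma abs_log_comparable {h : ℝ} (h0 : 0 < h) (h1 : h ≤ 1 / 2) :
    0 < |Real.log h| ∧ |Real.log h| ≤ 3 * (1 + max 0 (-Real.log h)) ∧
      1 + max 0 (-Real.log h) ≤ 3 * |Real.log h| := by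
  have h2 : Real.log h ≤ -Real.log 2 := by
    rw [← Real.log_inv]
    exact Real.log_le_log h0 (by linarith)
  have h3 := Real.log_two_gt_d9
  rw [abs_of_neg (by linarith), max_eq_right (by linarith)]
  refine ⟨by linarith, by linarith, by linarith⟩

lemma rpow_mul_abs_log_le_logGauge (α ν : ℝ) {h : ℝ} (h0 : 0 < h) (h1 : h ≤ 1 / 2) :
    h ^ α * |Real.log h| ^ ν ≤ 3 ^ |ν| * logGauge α ν h := by
  obtain ⟨h2, h3, h4⟩ := abs_log_comparable h0 h1
  unfold logGauge
  rw [mul_left_comm]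
  gcongr
  exact rpow_le_rpow_abs_mul ν h2 (by norm_num) h3 h4

lemma logGauge_le_rpow_mul_abs_log (α ν : ℝ) {h : ℝ} (h0 : 0 < h) (h1 : h ≤ 1 / 2) :
    logGauge α ν h ≤ 3 ^ |ν| * (h ^ α * |Real.log h| ^ ν) := by
  obtain ⟨h2, h3, h4⟩ := abs_log_comparable h0 h1
  unfold logGauge
  rw [mul_left_comm]
  gcongr
  exact rpow_le_rpow_abs_mul ν (by linarith [one_le_one_add_max_neg_log h]) (by norm_num) h4 h3

lemma continuousAt_logGauge (α ν : ℝ) {r : ℝ} (hr : 0 < r) : ContinuousAt (logGauge α ν) r := by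
  unfold logGauge
  have h3 := one_le_one_add_max_neg_log r
  refine (Real.continuousAt_rpow_const _ _ (Or.inl hr.ne')).mul (ContinuousAt.rpow_const ?_ (Or.inl (by linarith)))
  exact continuousAt_const.add (continuousAt_const.max (Real.continuousAt_log hr.ne').neg)

lemma tendsto_logGauge_zero {α : ℝ} (ν : ℝ) (hα : 0 < α) :
    Filter.Tendsto (logGauge α ν) (𝓝[>] 0) (𝓝 0) := by
  obtain ⟨K, hK, h⟩ := exists_logGauge_le_mul ν (half_lt_self hα)
  have hlim : Filter.Tendsto (fun r : ℝ => K * r ^ (α / 2) * logGauge α ν 1) (𝓝[>] 0) (𝓝 0) := by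
    have : ContinuousAt (fun r : ℝ => K * r ^ (α / 2) * logGauge α ν 1) 0 :=
      (continuousAt_const.mul (Real.continuousAt_rpow_const _ _ (Or.inr (by positivity)))).mul
        continuousAt_const
    have h2 := this.tendsto
    rw [Real.zero_rpow (by positivity)] at h2
    simpa using h2.mono_left nhdsWithin_le_nhds
  refine squeeze_zero' ?_ ?_ hlim
  · filter_upwards [self_mem_nhdsWithin] with r hr using (logGauge_pos α ν hr).le
  · filter_upwards [Ioo_mem_nhdsGT (zero_lt_one' ℝ)] with r hr
    have := h r r⁻¹ hr.1 (one_le_inv_iff₀.2 ⟨hr.1, hr.2.le⟩)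
    rwa [inv_mul_cancel₀ hr.1.ne', Real.inv_rpow hr.1.le, Real.rpow_neg hr.1.le, inv_inv] at this

/-! ### Cauchy type integrals and the jump of the winding integral -/

section CauchyTypeIntegrals

open Set Filter intervalIntegral

/-- Cauchy type integrals over a parametrized arc are holomorphic off the arc. -/
lemma hasDerivAt_cauchyTypeIntegral {a b : ℝ} {φ γ : ℝ → ℂ} (hφ : ContinuousOn φ (uIcc a b))
    (hγ : ContinuousOn γ (uIcc a b)) {z : ℂ} (hz : z ∉ γ '' uIcc a b) :
    HasDerivAt (fun z => ∫ t in a..b, φ t / (γ t - z)) (∫ t in a..b, φ t / (γ t - z) ^ 2) z := by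
  have hcl : IsClosed (γ '' uIcc a b) := (isCompact_uIcc.image_of_continuousOn hγ).isClosed
  obtain ⟨d, hd, hball⟩ := Metric.isOpen_iff.1 hcl.isOpen_compl z hz
  have hfar : ∀ t ∈ uIcc a b, ∀ x ∈ Metric.ball z (d / 2), d / 2 ≤ ‖γ t - x‖ := by
    intro t ht x hx
    have h1 : γ t ∉ Metric.ball z d := fun h => hball h (mem_image_of_mem γ ht)
    rw [Metric.mem_ball, not_lt] at h1
    have h2 := dist_triangle (γ t) x z
    rw [Metric.mem_ball] at hx
    rw [← dist_eq_norm]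
    linarith
  have hne : ∀ t ∈ uIcc a b, ∀ x ∈ Metric.ball z (d / 2), γ t - x ≠ 0 := fun t ht x hx =>
    norm_pos_iff.1 ((half_pos hd).trans_le (hfar t ht x hx))
  have hzz : z ∈ Metric.ball z (d / 2) := Metric.mem_ball_self (half_pos hd)
  have hc : ∀ x ∈ Metric.ball z (d / 2), ContinuousOn (fun t => φ t / (γ t - x)) (uIcc a b) :=
    fun x hx => hφ.div (hγ.sub continuousOn_const) fun t ht => hne t ht x hx
  have hc2 : ContinuousOn (fun t => φ t / (γ t - z) ^ 2) (uIcc a b) :=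
    hφ.div ((hγ.sub continuousOn_const).pow 2) fun t ht => pow_ne_zero 2 (hne t ht z hzz)
  refine (hasDerivAt_integral_of_dominated_loc_of_deriv_le (F := fun x t => φ t / (γ t - x))
    (F' := fun x t => φ t / (γ t - x) ^ 2) (bound := fun t => ‖φ t‖ / (d / 2) ^ 2)
    (Metric.ball_mem_nhds z (half_pos hd)) ?_ (hc z hzz).intervalIntegrable ?_ ?_ ?_ ?_).2
  · filter_upwards [Metric.ball_mem_nhds z (half_pos hd)] with x hx
    exact ((hc x hx).mono uIoc_subset_uIcc).aestronglyMeasurable measurableSet_uIoc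
  · exact (hc2.mono uIoc_subset_uIcc).aestronglyMeasurable measurableSet_uIoc
  · refine Eventually.of_forall fun t ht x hx => ?_
    rw [norm_div, norm_pow]
    gcongr
    exact hfar t (uIoc_subset_uIcc ht) x hx
  · exact (hφ.norm.div_const _).intervalIntegrable
  · refine Eventually.of_forall fun t ht x hx => ?_
    have h := hne t (uIoc_subset_uIcc ht) x hx
    have h1 := ((hasDerivAt_id' x).const_sub (γ t)).fun_inv h |>.const_mul (φ t)
    refine h1.congr_deriv ?_
    rw [neg_neg, mul_one_div]

/-- The integral of `dζ / (ζ - z)²` over an arc is the increment of the primitive. -/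
lemma integral_deriv_div_sq {a b : ℝ} {γ : ℝ → ℂ} (hγ : ContDiff ℝ 1 γ) {z : ℂ}
    (hz : z ∉ γ '' uIcc a b) :
    ∫ t in a..b, deriv γ t / (γ t - z) ^ 2 = (γ a - z)⁻¹ - (γ b - z)⁻¹ := by
  have hne : ∀ t ∈ uIcc a b, γ t - z ≠ 0 := fun t ht h =>
    hz ⟨t, ht, sub_eq_zero.1 h⟩
  rw [integral_eq_sub_of_hasDerivAt (f := fun t => -(γ t - z)⁻¹)]
  · ring
  · intro t ht
    have h := ((hγ.differentiable one_ne_zero t).hasDerivAt.sub_const z).fun_inv (hne t ht) |>.fun_neg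
    refine h.congr_deriv ?_
    rw [neg_div, neg_neg]
  · refine ContinuousOn.intervalIntegrable ?_
    exact (hγ.continuous_deriv le_rfl).continuousOn.div
      ((hγ.continuous.continuousOn.sub continuousOn_const).pow 2) fun t ht => pow_ne_zero 2 (hne t ht)

/-- The winding integral of a closed curve is constant on connected open sets off the curve. -/
lemma windingIntegral_eq_of_isPreconnected {a b : ℝ} {γ : ℝ → ℂ} (hγ : ContDiff ℝ 1 γ)
    (hab : γ a = γ b) {U : Set ℂ} (hU : IsOpen U) (hU' : IsPreconnected U)
    (hd : Disjoint U (range γ)) {z w : ℂ} (hz : z ∈ U) (hw : w ∈ U) :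
    ∫ t in a..b, deriv γ t / (γ t - z) = ∫ t in a..b, deriv γ t / (γ t - w) := by
  have h : ∀ x ∈ U, HasDerivAt (fun z => ∫ t in a..b, deriv γ t / (γ t - z)) 0 x := by
    intro x hx
    have hx' : x ∉ γ '' uIcc a b := fun h =>
      disjoint_left.1 hd hx (image_subset_range _ _ h)
    have := hasDerivAt_cauchyTypeIntegral (hγ.continuous_deriv le_rfl).continuousOn
      hγ.continuous.continuousOn hx'
    rwa [integral_deriv_div_sq hγ hx', hab, sub_self] at this
  exact hU.is_const_of_deriv_eq_zero hU'
    (fun x hx => (h x hx).differentiableAt.differentiableWithinAt)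
    (fun x hx => (h x hx).deriv) hz hw

/-- The factor `c` rotates the branch cut of the logarithm away from the arc. -/
lemma integral_deriv_div_eq_log {a b : ℝ} {σ : ℝ → ℂ} (hσ : ContDiff ℝ 1 σ) {z c : ℂ} (hc : c ≠ 0)
    (h : ∀ t ∈ uIcc a b, c * (σ t - z) ∈ Complex.slitPlane) :
    ∫ t in a..b, deriv σ t / (σ t - z) =
      Complex.log (c * (σ b - z)) - Complex.log (c * (σ a - z)) := by
  have hne : ∀ t ∈ uIcc a b, σ t - z ≠ 0 := fun t ht h0 => by
    have := Complex.slitPlane_ne_zero (h t ht)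
    rw [h0, mul_zero] at this
    exact this rfl
  rw [integral_eq_sub_of_hasDerivAt (f := fun t => Complex.log (c * (σ t - z)))]
  · intro t ht
    have h := (((hσ.differentiable one_ne_zero t).hasDerivAt.sub_const z).const_mul c).clog_real
      (h t ht)
    exact h.congr_deriv (mul_div_mul_left _ _ hc)
  · refine ContinuousOn.intervalIntegrable ?_
    exact (hσ.continuous_deriv le_rfl).continuousOn.div
      (hσ.continuous.continuousOn.sub continuousOn_const) hne

lemma eventually_intervalIntegrable_deriv_div {a b : ℝ} {σ : ℝ → ℂ} (hσ : ContDiff ℝ 1 σ)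
    (h : ∀ t ∈ uIcc a b, σ t ≠ 0) :
    ∀ᶠ z in 𝓝 (0 : ℂ), IntervalIntegrable (fun t => deriv σ t / (σ t - z)) MeasureTheory.volume a b := by
  have hcl : IsClosed (σ '' uIcc a b) := (isCompact_uIcc.image hσ.continuous).isClosed
  have h0 : (0 : ℂ) ∈ (σ '' uIcc a b)ᶜ := by
    rintro ⟨t, ht, h0⟩
    exact h t ht h0
  filter_upwards [hcl.isOpen_compl.mem_nhds h0] with z hz
  refine ContinuousOn.intervalIntegrable ?_
  exact (hσ.continuous_deriv le_rfl).continuousOn.div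
      (hσ.continuous.continuousOn.sub continuousOn_const) fun t ht h0 =>
        hz ⟨t, ht, sub_eq_zero.1 h0⟩

/-- An arc that misses `0` does not contribute to the jump at `0`. -/
lemma tendsto_jump_zero {a b : ℝ} {σ : ℝ → ℂ} (hσ : ContDiff ℝ 1 σ)
    (h : ∀ t ∈ uIcc a b, σ t ≠ 0) :
    Tendsto (fun ε : ℝ => (∫ t in a..b, deriv σ t / (σ t - ε * Complex.I)) -
      ∫ t in a..b, deriv σ t / (σ t - -(ε * Complex.I))) (𝓝[>] 0) (𝓝 0) := by
  have h0 : (0 : ℂ) ∉ σ '' uIcc a b := by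
    rintro ⟨t, ht, h0⟩
    exact h t ht h0
  have hc := (hasDerivAt_cauchyTypeIntegral (hσ.continuous_deriv le_rfl).continuousOn
      hσ.continuous.continuousOn h0).continuousAt.tendsto
  have h1 : Tendsto (fun ε : ℝ => (ε : ℂ) * Complex.I) (𝓝[>] 0) (𝓝 0) := by
    have : Continuous fun ε : ℝ => (ε : ℂ) * Complex.I := by fun_prop
    simpa using this.tendsto 0 |>.mono_left (nhdsWithin_le_nhds (s := Ioi 0))
  have h2 : Tendsto (fun ε : ℝ => -((ε : ℂ) * Complex.I)) (𝓝[>] 0) (𝓝 0) := by simpa using h1.neg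
  simpa using (hc.comp h1).sub (hc.comp h2)

/-- The winding integral jumps by `2πi` across a regular curve, here normalized to pass through
`0` with unit tangent. -/
lemma tendsto_windingIntegral_jump {σ : ℝ → ℂ} (hσ : ContDiff ℝ 1 σ) (h0 : σ 0 = 0)
    (h1 : deriv σ 0 = 1) (hne : ∀ t ∈ Icc (-1 / 2 : ℝ) (1 / 2), t ≠ 0 → σ t ≠ 0) :
    Tendsto (fun ε : ℝ => (∫ t in (-1 / 2 : ℝ)..(1 / 2), deriv σ t / (σ t - ε * Complex.I)) -
      ∫ t in (-1 / 2 : ℝ)..(1 / 2), deriv σ t / (σ t - -(ε * Complex.I)))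
      (𝓝[>] 0) (𝓝 (2 * Real.pi * Complex.I)) := by
  -- on `[-η, η]` the curve stays in a double cone around the real axis, so that the logarithm is
  -- a primitive for both sides, with its cut along the upper or the lower imaginary axis
  obtain ⟨η, hη, hη2, hloc⟩ : ∃ η : ℝ, 0 < η ∧ η ≤ 1 / 2 ∧
      ∀ t : ℝ, |t| ≤ η → ‖σ t - t‖ ≤ 1 / 2 * |t| := by
    have hd : HasDerivAt σ 1 0 := h1 ▸ (hσ.differentiable one_ne_zero 0).hasDerivAt
    have := (hasDerivAt_iff_isLittleO.1 hd).def (by norm_num : (0 : ℝ) < 1 / 2)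
    obtain ⟨r, hr, hb⟩ := Metric.eventually_nhds_iff.1 this
    refine ⟨min (r / 2) (1 / 2), by positivity, min_le_right _ _, fun t ht => ?_⟩
    have := hb (y := t) (by
      rw [Real.dist_eq, sub_zero]
      have := ht.trans (min_le_left _ _)
      linarith)
    simpa [h0] using this
  have hre : ∀ t : ℝ, |t| ≤ η → |(σ t).re - t| ≤ 1 / 2 * |t| := fun t ht => by
    have := (Complex.abs_re_le_norm (σ t - t)).trans (hloc t ht)
    simpa using this
  have huI : uIcc (-η) η = Icc (-η) η := uIcc_of_le (by linarith)
  have hsp : ∀ ε : ℝ, 0 ≤ ε → ∀ t ∈ uIcc (-η) η, (ε ≠ 0 ∨ t ≠ 0) →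
      Complex.I * (σ t - ε * Complex.I) ∈ Complex.slitPlane ∧
      -Complex.I * (σ t - -(ε * Complex.I)) ∈ Complex.slitPlane := by
    intro ε hε t ht hor
    rw [huI, mem_Icc, ← abs_le] at ht
    have h2 := hre t ht
    rcases eq_or_ne t 0 with rfl | ht0
    · have : 0 < ε := lt_of_le_of_ne hε (hor.resolve_right (by simp)).symm
      constructor <;> left <;> simp [h0, this]
    · have h3 : (σ t).re ≠ 0 := by
        intro h3
        rw [h3, zero_sub, abs_neg] at h2
        have := abs_pos.2 ht0
        linarith
      constructor <;> right <;> simp [h3]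
  have hlim : Tendsto (fun ε : ℝ => (∫ t in (-η)..η, deriv σ t / (σ t - ε * Complex.I)) -
      ∫ t in (-η)..η, deriv σ t / (σ t - -(ε * Complex.I)))
      (𝓝[>] 0) (𝓝 (2 * Real.pi * Complex.I)) := by
    have hev : ∀ᶠ ε : ℝ in 𝓝[>] 0,
        (Complex.log (Complex.I * (σ η - ε * Complex.I)) -
          Complex.log (Complex.I * (σ (-η) - ε * Complex.I))) -
        (Complex.log (-Complex.I * (σ η - -(ε * Complex.I))) -
          Complex.log (-Complex.I * (σ (-η) - -(ε * Complex.I)))) =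
        (∫ t in (-η)..η, deriv σ t / (σ t - ε * Complex.I)) -
      ∫ t in (-η)..η, deriv σ t / (σ t - -(ε * Complex.I)) := by
      filter_upwards [self_mem_nhdsWithin] with ε hε
      rw [integral_deriv_div_eq_log hσ Complex.I_ne_zero
          fun t ht => (hsp ε (le_of_lt hε) t ht (Or.inl (ne_of_gt hε))).1,
        integral_deriv_div_eq_log hσ (neg_ne_zero.2 Complex.I_ne_zero)
          fun t ht => (hsp ε (le_of_lt hε) t ht (Or.inl (ne_of_gt hε))).2]
    refine Tendsto.congr' hev ?_
    have hlog : ∀ (c s : ℂ) (t : ℝ), c * σ t ∈ Complex.slitPlane →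
        Tendsto (fun ε : ℝ => Complex.log (c * (σ t - s * (ε * Complex.I)))) (𝓝[>] 0)
          (𝓝 (Complex.log (c * σ t))) := by
      intro c s t h
      have : ContinuousAt (fun ε : ℝ => Complex.log (c * (σ t - s * (ε * Complex.I)))) 0 := by
        refine ContinuousAt.clog (by fun_prop) ?_
        simpa using h
      simpa using this.tendsto.mono_left (nhdsWithin_le_nhds (s := Ioi 0))
    have hmem : ∀ t ∈ uIcc (-η) η, t ≠ 0 →
        Complex.I * σ t ∈ Complex.slitPlane ∧ -Complex.I * σ t ∈ Complex.slitPlane := by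
      intro t ht ht0
      simpa using hsp 0 le_rfl t ht (Or.inr ht0)
    have e1 := hmem η right_mem_uIcc hη.ne'
    have e2 := hmem (-η) left_mem_uIcc (by linarith)
    have hL := ((hlog Complex.I 1 η e1.1).sub (hlog Complex.I 1 (-η) e2.1)).sub
      ((hlog (-Complex.I) (-1) η e1.2).sub (hlog (-Complex.I) (-1) (-η) e2.2))
    simp only [one_mul, neg_one_mul] at hL
    convert hL using 2
    have hp : 0 < (Complex.I * σ η).im := by
      have := hre η (by rw [abs_of_pos hη])
      rw [abs_of_pos hη, abs_le] at this
      simp only [Complex.mul_im, Complex.I_re, Complex.I_im]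
      linarith
    have hm : (Complex.I * σ (-η)).im < 0 := by
      have := hre (-η) (by rw [abs_neg, abs_of_pos hη])
      rw [abs_neg, abs_of_pos hη, abs_le] at this
      simp only [Complex.mul_im, Complex.I_re, Complex.I_im]
      linarith
    simp only [Complex.log, neg_mul, norm_neg, Complex.arg_neg_eq_arg_sub_pi_of_im_pos hp,
      Complex.arg_neg_eq_arg_add_pi_of_im_neg hm]
    push_cast
    ring
  have hl : ∀ t ∈ uIcc (-1 / 2) (-η), σ t ≠ 0 := by
    intro t ht
    rw [uIcc_of_le (by linarith)] at ht
    exact hne t ⟨ht.1, by linarith [ht.2]⟩ (by linarith [ht.2])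
  have hr : ∀ t ∈ uIcc η (1 / 2), σ t ≠ 0 := by
    intro t ht
    rw [uIcc_of_le (by linarith)] at ht
    exact hne t ⟨by linarith [ht.1], ht.2⟩ (by linarith [ht.1])
  have hsum := ((tendsto_jump_zero hσ hl).add hlim).add (tendsto_jump_zero hσ hr)
  rw [zero_add, add_zero] at hsum
  have hp : Tendsto (fun ε : ℝ => (ε : ℂ) * Complex.I) (𝓝[>] 0) (𝓝 0) := by
    have : Continuous fun ε : ℝ => (ε : ℂ) * Complex.I := by fun_prop
    simpa using this.tendsto 0 |>.mono_left (nhdsWithin_le_nhds (s := Ioi 0))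
  have hm : Tendsto (fun ε : ℝ => -((ε : ℂ) * Complex.I)) (𝓝[>] 0) (𝓝 0) := by simpa using hp.neg
  refine Tendsto.congr' ?_ hsum
  filter_upwards [self_mem_nhdsWithin, hp.eventually (eventually_intervalIntegrable_deriv_div hσ hl),
    hm.eventually (eventually_intervalIntegrable_deriv_div hσ hl),
    hp.eventually (eventually_intervalIntegrable_deriv_div hσ hr),
    hm.eventually (eventually_intervalIntegrable_deriv_div hσ hr)] with ε hε i1 i2 i3 i4
  have hmid : ∀ t ∈ uIcc (-η) η, σ t - ε * Complex.I ≠ 0 ∧ σ t - -(ε * Complex.I) ≠ 0 := by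
    intro t ht
    have := hsp ε (le_of_lt hε) t ht (Or.inl (ne_of_gt hε))
    exact ⟨right_ne_zero_of_mul (Complex.slitPlane_ne_zero this.1),
      right_ne_zero_of_mul (Complex.slitPlane_ne_zero this.2)⟩
  have m1 : IntervalIntegrable (fun t => deriv σ t / (σ t - ε * Complex.I))
      MeasureTheory.volume (-η) η :=
    ((hσ.continuous_deriv le_rfl).continuousOn.div
      (hσ.continuous.continuousOn.sub continuousOn_const)
      fun t ht => (hmid t ht).1).intervalIntegrable
  have m2 : IntervalIntegrable (fun t => deriv σ t / (σ t - -(ε * Complex.I)))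
      MeasureTheory.volume (-η) η :=
    ((hσ.continuous_deriv le_rfl).continuousOn.div
      (hσ.continuous.continuousOn.sub continuousOn_const)
      fun t ht => (hmid t ht).2).intervalIntegrable
  rw [← integral_add_adjacent_intervals (i1.trans m1) i3, ← integral_add_adjacent_intervals i1 m1,
    ← integral_add_adjacent_intervals (i2.trans m2) i4, ← integral_add_adjacent_intervals i2 m2]
  ring

end CauchyTypeIntegrals

/-! ### The interior cone condition -/

section ConeCondition

open Set Filter

/-- The open cone of directions within angle `π/4` of the left normal `iτ` of `τ`. -/
def leftCone (τ : ℂ) : Set ℂ := {v | |(v / τ).re| < (v / τ).im}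

lemma isOpen_leftCone (τ : ℂ) : IsOpen (leftCone τ) :=
  isOpen_lt (by fun_prop) (by fun_prop)

lemma convex_leftCone (τ : ℂ) : Convex ℝ (leftCone τ) := by
  rw [convex_iff_forall_pos]
  intro x hx y hy a b ha hb _
  simp only [leftCone, mem_ofPred_eq, abs_lt, add_div, Complex.real_smul, mul_div_assoc,
    Complex.add_re, Complex.add_im, Complex.re_ofReal_mul, Complex.im_ofReal_mul] at hx hy ⊢
  constructor <;> nlinarith [mul_pos ha (sub_pos.2 hx.1), mul_pos ha (sub_pos.2 hx.2),
    mul_pos hb (sub_pos.2 hy.1), mul_pos hb (sub_pos.2 hy.2)]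

lemma mul_mem_leftCone {τ v : ℂ} (hv : v ∈ leftCone τ) {s : ℝ} (hs : 0 < s) :
    (s : ℂ) * v ∈ leftCone τ := by
  simp only [leftCone, mem_ofPred_eq, mul_div_assoc, Complex.re_ofReal_mul, Complex.im_ofReal_mul,
    abs_mul, abs_of_pos hs] at hv ⊢
  gcongr

lemma neg_mem_leftCone_neg {τ v : ℂ} (hv : v ∈ leftCone τ) : -v ∈ leftCone (-τ) := by
  simpa only [leftCone, mem_ofPred_eq, neg_div_neg_eq] using hv

lemma ball_subset_leftCone {τ : ℂ} (hτ : τ ≠ 0) {s : ℝ} {v : ℂ}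
    (hv : ‖v - s * (Complex.I * τ / ‖τ‖)‖ < s / 2) : v ∈ leftCone τ := by
  have hτ' : 0 < ‖τ‖ := norm_pos_iff.2 hτ
  have h1 : ‖v / τ - ((s / ‖τ‖ : ℝ) : ℂ) * Complex.I‖ < s / ‖τ‖ / 2 := by
    have : v / τ - ((s / ‖τ‖ : ℝ) : ℂ) * Complex.I = (v - s * (Complex.I * τ / ‖τ‖)) / τ := by
      push_cast
      field_simp
    rw [this, norm_div, div_right_comm]
    gcongr
  have h2 := (Complex.abs_re_le_norm _).trans_lt h1
  have h3 := (Complex.abs_im_le_norm _).trans_lt h1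
  simp only [Complex.sub_re, Complex.sub_im, Complex.re_ofReal_mul, Complex.im_ofReal_mul,
    Complex.I_re, Complex.I_im, mul_zero, sub_zero, mul_one] at h2 h3
  rw [abs_lt] at h3
  simp only [leftCone, mem_ofPred_eq]
  linarith [h3.1]

lemma Function.Periodic.eq_of_injOn {γ : ℝ → ℂ} (hp : Function.Periodic γ 1)
    (hi : InjOn γ (Ico 0 1)) {s t : ℝ} (h : γ s = γ t) (hst : |s - t| < 1) : s = t := by
  have hf : ∀ x, γ (Int.fract x) = γ x := fun x => by
    have := hp.sub_zsmul_eq ⌊x⌋ (x := x)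
    rwa [zsmul_one] at this
  have h1 : Int.fract s = Int.fract t :=
    hi ⟨Int.fract_nonneg s, Int.fract_lt_one s⟩ ⟨Int.fract_nonneg t, Int.fract_lt_one t⟩
      (by rw [hf, hf, h])
  obtain ⟨z, hz⟩ := Int.fract_eq_fract.1 h1
  rw [hz] at hst
  have : z = 0 := Int.abs_lt_one_iff.1 (by exact_mod_cast hst)
  rw [this, Int.cast_zero] at hz
  linarith

/-- The winding integrals on the two sides of a point of a regular Jordan curve differ. -/
lemma not_eventually_windingIntegral_eq {γ : ℝ → ℂ} (hγ : ContDiff ℝ 1 γ)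
    (hp : Function.Periodic γ 1) (hi : InjOn γ (Ico 0 1)) {t₀ : ℝ} (h0 : deriv γ t₀ ≠ 0) :
    ¬ ∀ᶠ ε : ℝ in 𝓝[>] 0,
      (∫ t in (0 : ℝ)..1, deriv γ t / (γ t - (γ t₀ + ε * (Complex.I * deriv γ t₀)))) =
      ∫ t in (0 : ℝ)..1, deriv γ t / (γ t - (γ t₀ - ε * (Complex.I * deriv γ t₀))) := by
  intro hev
  set τ := deriv γ t₀ with hτ
  -- move the point to `0`, the tangent to `1`, and the period to `[-1/2, 1/2]`
  set σ : ℝ → ℂ := fun t => (γ (t₀ + t) - γ t₀) / τ with hσ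
  have hσd : ∀ t, deriv σ t = deriv γ (t₀ + t) / τ := by
    intro t
    have h1 : HasDerivAt (fun t => γ (t₀ + t)) (deriv γ (t₀ + t)) t :=
      (hγ.differentiable one_ne_zero _).hasDerivAt.comp_const_add t₀ t
    exact ((h1.sub_const _).div_const τ).deriv
  have hσc : ContDiff ℝ 1 σ := by
    have : ContDiff ℝ 1 fun t => γ (t₀ + t) := hγ.comp (contDiff_const.add contDiff_id)
    exact (this.sub contDiff_const).div_const τ
  have hW : ∀ w : ℂ, (∫ t in (0 : ℝ)..1, deriv γ t / (γ t - (γ t₀ + w * τ))) =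
      ∫ t in (-1 / 2 : ℝ)..(1 / 2), deriv σ t / (σ t - w) := by
    intro w
    have hper : Function.Periodic (fun t => deriv γ t / (γ t - (γ t₀ + w * τ))) 1 := by
      intro t
      have h2 : deriv γ (t + 1) = deriv γ t := by
        rw [← deriv_comp_add_const]
        congr 1
        exact funext hp
      simp only [hp t, h2]
    have h3 := hper.intervalIntegral_add_eq 0 (t₀ - 1 / 2)
    rw [zero_add] at h3
    rw [h3]
    have h4 := intervalIntegral.integral_comp_add_left (a := (-1 / 2 : ℝ)) (b := 1 / 2)
      (fun t => deriv γ t / (γ t - (γ t₀ + w * τ))) t₀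
    rw [show t₀ - 1 / 2 = t₀ + -1 / 2 by ring, show t₀ + -1 / 2 + 1 = t₀ + 1 / 2 by ring, ← h4]
    congr 1
    funext t
    rw [hσd]
    simp only [hσ]
    rw [div_div, mul_sub, mul_div_cancel₀ _ h0]
    congr 1
    ring
  have hlim := tendsto_windingIntegral_jump hσc (by simp [hσ]) (by simp [hσd, ← hτ, div_self h0]) (by
    intro t ht ht0 h
    simp only [hσ, div_eq_zero_iff, h0, or_false, sub_eq_zero] at h
    have := hp.eq_of_injOn hi h (by
      rw [add_sub_cancel_left, abs_lt]
      constructor <;> linarith [ht.1, ht.2])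
    exact ht0 (by linarith))
  have h0 : Tendsto (fun _ : ℝ => (0 : ℂ)) (𝓝[>] 0) (𝓝 (2 * Real.pi * Complex.I)) := by
    refine hlim.congr' ?_
    filter_upwards [hev] with ε h
    rw [← hW, ← hW, sub_eq_zero]
    convert h using 5 <;> ring
  have := tendsto_nhds_unique h0 tendsto_const_nhds
  simp [Real.pi_ne_zero] at this

variable {α : ℝ} {D : Set ℂ} {N : ℕ} {γ : Fin N → ℝ → ℂ}

lemma IsC1HolderBoundary.disjoint_range (h : IsC1HolderBoundary α D γ) (hD : IsOpen D) (j : Fin N) :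
    Disjoint D (range (γ j)) := by
  have h1 : range (γ j) ⊆ frontier D := h.frontier_eq ▸ subset_iUnion (fun j => range (γ j)) j
  exact (disjoint_frontier_iff_isOpen.2 hD).symm.mono_right h1

/-- Quantitative inverse-function behaviour of a regular `C¹` curve near a parameter. -/
lemma exists_forall_norm_sub_le {γ : ℝ → ℂ} (hγ : ContDiff ℝ 1 γ) {t₀ : ℝ} (h0 : deriv γ t₀ ≠ 0) :
    ∃ η > 0, (∀ s ∈ Metric.ball t₀ η, ∀ t ∈ Metric.ball t₀ η,
      ‖γ s - γ t - (s - t : ℝ) * deriv γ t₀‖ ≤ 1 / 4 * (|s - t| * ‖deriv γ t₀‖)) ∧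
      ∀ t ∈ Metric.ball t₀ η, ‖deriv γ t - deriv γ t₀‖ ≤ 1 / 4 * ‖deriv γ t₀‖ := by
  have hτ : 0 < ‖deriv γ t₀‖ := norm_pos_iff.2 h0
  have h1 := (hγ.contDiffAt.hasStrictDerivAt one_ne_zero : HasStrictDerivAt γ (deriv γ t₀) t₀)
  have h2 := h1.isLittleO.def (c := 1 / 4 * ‖deriv γ t₀‖) (by positivity)
  obtain ⟨η₁, hη₁, hb₁⟩ := Metric.eventually_nhds_iff.1 h2
  obtain ⟨η₂, hη₂, hb₂⟩ := Metric.continuousAt_iff.1 (hγ.continuous_deriv le_rfl).continuousAt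
    (1 / 4 * ‖deriv γ t₀‖) (by positivity)
  refine ⟨min η₁ η₂, lt_min hη₁ hη₂, fun s hs t ht => ?_, fun t ht => ?_⟩
  · have := hb₁ (y := (s, t)) (by
      rw [Prod.dist_eq]
      exact max_lt (lt_of_lt_of_le hs (min_le_left _ _)) (lt_of_lt_of_le ht (min_le_left _ _)))
    simp only [ContinuousLinearMap.toSpanSingleton_apply] at this
    simpa [Real.norm_eq_abs, mul_comm, mul_left_comm, mul_assoc] using this
  · have := hb₂ (x := t) (lt_of_lt_of_le ht (min_le_right _ _))
    rw [dist_eq_norm] at this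
    exact this.le

/-- Near a boundary point, the boundary consists of a single arc which is a Lipschitz graph over
the tangent line. -/
lemma IsC1HolderBoundary.exists_local_graph (h : IsC1HolderBoundary α D γ) (j : Fin N) (t₀ : ℝ) :
    ∃ ρ > 0, (∀ ζ ∈ frontier D, ∀ ζ' ∈ frontier D, ζ ∈ Metric.ball (γ j t₀) ρ →
        ζ' ∈ Metric.ball (γ j t₀) ρ → ζ - ζ' ∉ leftCone (deriv (γ j) t₀)) ∧
      ∀ ζ ∈ frontier D, ζ ∈ Metric.ball (γ j t₀) ρ →
        ∃ t, γ j t = ζ ∧ Complex.I * deriv (γ j) t ∈ leftCone (deriv (γ j) t₀) := by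
  set τ := deriv (γ j) t₀ with hτ
  have h0 : τ ≠ 0 := h.deriv_ne_zero j t₀
  have hτ0 : 0 < ‖τ‖ := norm_pos_iff.2 h0
  obtain ⟨η₀, hη₀, hb₁', hb₂'⟩ := exists_forall_norm_sub_le (h.contDiff j) h0
  obtain ⟨η, hη, hη1, hηη⟩ : ∃ η > 0, η < 1 ∧ η ≤ η₀ :=
    ⟨min η₀ (1 / 2), by positivity, (min_le_right _ _).trans_lt (by norm_num), min_le_left _ _⟩
  have hcpt : ∀ k, range (γ k) = γ k '' Icc 0 1 := fun k => by
    have := (h.periodic k).image_Icc one_pos 0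
    rw [zero_add] at this
    exact this.symm
  -- the part of the boundary away from the parameter `t₀` of `γ j`; it is compact and misses `γ j t₀`
  set K : Set ℂ := (⋃ k ∈ {k : Fin N | k ≠ j}, range (γ k)) ∪
    γ j '' Icc (t₀ + η / 2) (t₀ + 1 - η / 2) with hK
  have hKc : IsCompact K := by
    refine IsCompact.union ((Set.toFinite _).isCompact_biUnion fun k _ => ?_) ?_
    · rw [hcpt k]
      exact isCompact_Icc.image (h.contDiff k).continuous
    · exact isCompact_Icc.image (h.contDiff j).continuous
  have hpK : γ j t₀ ∈ Kᶜ := by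
    rintro (hk | ⟨t, ht, hk⟩)
    · simp only [mem_iUnion] at hk
      obtain ⟨k, hkj, hk⟩ := hk
      exact disjoint_left.1 (h.pairwise_disjoint k j hkj) hk (mem_range_self _)
    · have := (h.periodic j).eq_of_injOn (h.injOn j) hk (by
        rw [abs_lt]; constructor <;> linarith [ht.1, ht.2])
      linarith [ht.1]
  obtain ⟨ρ, hρ, hball⟩ := Metric.isOpen_iff.1 hKc.isClosed.isOpen_compl _ hpK
  have hpar : ∀ ζ ∈ frontier D, ζ ∈ Metric.ball (γ j t₀) ρ →
      ∃ t ∈ Metric.ball t₀ η₀, γ j t = ζ := by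
    intro ζ hζ hζρ
    have hζK := hball hζρ
    rw [h.frontier_eq, mem_iUnion] at hζ
    obtain ⟨k, hk⟩ := hζ
    have hkj : k = j := by
      by_contra hkj
      exact hζK (Or.inl (mem_biUnion (show k ∈ {k : Fin N | k ≠ j} from hkj) hk))
    subst hkj
    obtain ⟨t', rfl⟩ := hk
    obtain ⟨t, ht, htt⟩ := (h.periodic k).exists_mem_Ico one_pos t' (t₀ - η / 2)
    rw [htt] at hζK ⊢
    have ht' : t < t₀ + η / 2 := by
      by_contra h'
      exact hζK (Or.inr ⟨t, ⟨by linarith, by linarith [ht.2]⟩, rfl⟩)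
    refine ⟨t, ?_, rfl⟩
    rw [Metric.mem_ball, Real.dist_eq, abs_lt]
    constructor <;> linarith [ht.1]
  refine ⟨ρ, hρ, fun ζ hζ ζ' hζ' hb hb' => ?_, fun ζ hζ hb => ?_⟩
  · obtain ⟨s, hs, rfl⟩ := hpar ζ hζ hb
    obtain ⟨t, ht, rfl⟩ := hpar ζ' hζ' hb'
    have h3 := hb₁' s hs t ht
    have h4 : ‖(γ j s - γ j t) / τ - ((s - t : ℝ) : ℂ)‖ ≤ 1 / 4 * |s - t| := by
      have : (γ j s - γ j t) / τ - ((s - t : ℝ) : ℂ) = (γ j s - γ j t - (s - t : ℝ) * τ) / τ := by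
        field_simp
      rw [this, norm_div, div_le_iff₀ hτ0]
      linarith
    have h5 := (Complex.abs_re_le_norm _).trans h4
    have h6 := (Complex.abs_im_le_norm _).trans h4
    simp only [Complex.sub_re, Complex.sub_im, Complex.ofReal_re, Complex.ofReal_im, sub_zero] at h5 h6
    simp only [leftCone, mem_ofPred_eq, not_lt]
    have h7 := le_abs_self ((γ j s - γ j t) / τ).im
    have h8 := abs_sub_abs_le_abs_sub (s - t) ((γ j s - γ j t) / τ).re
    rw [abs_sub_comm (s - t)] at h8
    have := abs_nonneg (s - t)
    linarith
  · obtain ⟨t, ht, rfl⟩ := hpar ζ hζ hb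
    refine ⟨t, rfl, ball_subset_leftCone h0 (s := ‖τ‖) ?_⟩
    have : Complex.I * deriv (γ j) t - ‖τ‖ * (Complex.I * τ / ‖τ‖) =
        Complex.I * (deriv (γ j) t - τ) := by
      have : (‖τ‖ : ℂ) ≠ 0 := by exact_mod_cast hτ0.ne'
      field_simp
    rw [this, norm_mul, Complex.norm_I, one_mul]
    have := hb₂' t ht
    linarith

/-- The winding integral is constant on the truncated cone `q + leftCone τ ∩ B(0, ρ)` when the curve
misses it, the cone being convex. -/
lemma windingIntegral_eq_on_cone {γ : ℝ → ℂ} (hγ : ContDiff ℝ 1 γ) {a b : ℝ} (hab : γ a = γ b)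
    {τ q v w : ℂ} {ρ : ℝ}
    (hd : ∀ v ∈ leftCone τ, ‖v‖ < ρ → q + v ∉ range γ) (hv : v ∈ leftCone τ) (hvρ : ‖v‖ < ρ)
    (hw : w ∈ leftCone τ) (hwρ : ‖w‖ < ρ) :
    ∫ t in a..b, deriv γ t / (γ t - (q + v)) = ∫ t in a..b, deriv γ t / (γ t - (q + w)) := by
  have hc : Convex ℝ ((fun x => -q + x) ⁻¹' (leftCone τ ∩ Metric.ball 0 ρ)) :=
    ((convex_leftCone τ).inter (convex_ball 0 ρ)).translate_preimage_right (-q)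
  refine windingIntegral_eq_of_isPreconnected hγ hab
    (U := (fun x => -q + x) ⁻¹' (leftCone τ ∩ Metric.ball 0 ρ)) ?_ hc.isPreconnected ?_ ?_ ?_
  · exact ((isOpen_leftCone τ).inter Metric.isOpen_ball).preimage (by fun_prop)
  · refine disjoint_left.2 fun x hx hx' => hd _ hx.1 (mem_ball_zero_iff.1 hx.2) ?_
    simpa using hx'
  · simpa using ⟨hv, hvρ⟩
  · simpa using ⟨hw, hwρ⟩

/-- Near a boundary point, `D` does not meet the cones on the right of the boundary: the winding
integral of the boundary curve is constant on `D` and jumps across the curve. -/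
lemma IsC1HolderBoundary.exists_sub_notMem (h : IsC1HolderBoundary α D γ) (hD : IsOpen D)
    (hDc : IsConnected D) (j : Fin N) (t₀ : ℝ) :
    ∃ ρ > 0, ∀ q ∈ frontier D, q ∈ Metric.ball (γ j t₀) ρ → ∀ v ∈ leftCone (deriv (γ j) t₀),
      ‖v‖ < ρ → q - v ∉ D := by
  obtain ⟨ρ, hρ, hgr, htan⟩ := h.exists_local_graph j t₀
  refine ⟨ρ / 2, half_pos hρ, fun q hq hqρ v hv hvρ hmem => ?_⟩
  set τ := deriv (γ j) t₀ with hτ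
  have hclosed : γ j 0 = γ j 1 := by simpa using (h.periodic j 0).symm
  have hfr : range (γ j) ⊆ frontier D := h.frontier_eq ▸ subset_iUnion (fun j => range (γ j)) j
  have hqρ' : q ∈ Metric.ball (γ j t₀) ρ := Metric.ball_subset_ball (by linarith) hqρ
  have hadd : ∀ v : ℂ, ‖v‖ < ρ / 2 → q + v ∈ Metric.ball (γ j t₀) ρ := by
    intro v hv
    rw [Metric.mem_ball] at hqρ ⊢
    have h1 := dist_triangle (q + v) q (γ j t₀)
    rw [dist_self_add_left] at h1
    linarith
  have hup : ∀ v ∈ leftCone τ, ‖v‖ < ρ / 2 → q + v ∉ range (γ j) := by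
    intro v hv hvρ hmem
    refine hgr (q + v) (hfr hmem) q hq (hadd v hvρ) hqρ' ?_
    rwa [add_sub_cancel_left]
  have hdown : ∀ v ∈ leftCone (-τ), ‖v‖ < ρ / 2 → q + v ∉ range (γ j) := by
    intro v hv hvρ hmem
    refine hgr q hq (q + v) (hfr hmem) hqρ' (hadd v hvρ) ?_
    have := neg_mem_leftCone_neg hv
    rw [neg_neg] at this
    rwa [sub_add_cancel_left]
  -- `D` contains points on the left of `q`; if it also contains `q - v`, the two sides of the
  -- curve at `q` have the same winding integral
  obtain ⟨t, rfl, ht⟩ := htan q hq hqρ'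
  refine not_eventually_windingIntegral_eq (h.contDiff j) (h.periodic j) (h.injOn j)
    (h.deriv_ne_zero j t) ?_
  have hsmall : ∀ᶠ ε : ℝ in 𝓝[>] 0, ‖(ε : ℂ) * (Complex.I * deriv (γ j) t)‖ < ρ / 2 := by
    have hc : ContinuousAt (fun ε : ℝ => ‖(ε : ℂ) * (Complex.I * deriv (γ j) t)‖) 0 := by fun_prop
    have := hc.tendsto.mono_left (nhdsWithin_le_nhds (s := Ioi 0))
    refine this.eventually (gt_mem_nhds ?_)
    simpa using hρ
  filter_upwards [hsmall, self_mem_nhdsWithin, h.left_mem j t] with ε hε hε0 hεD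
  have hm := mul_mem_leftCone ht hε0
  rw [windingIntegral_eq_of_isPreconnected (h.contDiff j) hclosed hD hDc.isPreconnected
    (h.disjoint_range hD j) hεD hmem, sub_eq_add_neg, sub_eq_add_neg]
  exact windingIntegral_eq_on_cone (h.contDiff j) hclosed hdown (neg_mem_leftCone_neg hv)
    (by rwa [norm_neg]) (neg_mem_leftCone_neg hm) (by rwa [norm_neg])

/-- A local cone condition at a boundary point. -/
lemma IsC1HolderBoundary.exists_add_mem (h : IsC1HolderBoundary α D γ) (hD : IsOpen D)
    (hDc : IsConnected D) (j : Fin N) (t₀ : ℝ) :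
    ∃ ρ > 0, ∀ z ∈ D, z ∈ Metric.ball (γ j t₀) ρ → ∀ v ∈ leftCone (deriv (γ j) t₀),
      ‖v‖ < ρ → z + v ∈ D := by
  obtain ⟨ρ, hρ, hq⟩ := h.exists_sub_notMem hD hDc j t₀
  refine ⟨ρ / 2, half_pos hρ, fun z hz hzρ v hv hvρ => ?_⟩
  by_contra hnot
  -- the first point of the segment from `z` to `z + v` outside `D`
  set S : Set ℝ := {θ | θ ∈ Icc (0 : ℝ) 1 ∧ z + θ * v ∉ D} with hS
  have hScl : IsClosed S := by
    refine isClosed_Icc.inter (hD.isClosed_compl.preimage ?_)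
    fun_prop
  have hSne : S.Nonempty := ⟨1, by simp [hS, hnot]⟩
  have hSbd : BddBelow S := ⟨0, fun θ hθ => hθ.1.1⟩
  have hmem := hScl.csInf_mem hSne hSbd
  set θ := sInf S with hθ
  have hθ0 : 0 < θ := by
    refine lt_of_le_of_ne hmem.1.1 fun h0 => hmem.2 ?_
    rw [← h0]
    simpa using hz
  have hlt : ∀ x ∈ Ico 0 θ, z + x * v ∈ D := by
    intro x hx
    by_contra hxD
    exact absurd (csInf_le hSbd (show x ∈ S from ⟨⟨hx.1, hx.2.le.trans hmem.1.2⟩, hxD⟩))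
      (not_le.2 hx.2)
  have hcl : z + θ * v ∈ closure D := by
    have hc : ContinuousAt (fun x : ℝ => z + x * v) θ := by fun_prop
    refine mem_closure_of_tendsto (hc.tendsto.mono_left (nhdsWithin_le_nhds (s := Iio θ))) ?_
    filter_upwards [Ioo_mem_nhdsLT hθ0] with x hx using hlt x ⟨hx.1.le, hx.2⟩
  have hfr : z + θ * v ∈ frontier D := by
    rw [hD.frontier_eq]
    exact ⟨hcl, hmem.2⟩
  have hn : ‖(θ : ℂ) * v‖ < ρ / 2 := by
    rw [norm_mul, Complex.norm_real, Real.norm_of_nonneg hθ0.le]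
    nlinarith [norm_nonneg v, hmem.1.2]
  refine hq _ hfr ?_ (θ * v) (mul_mem_leftCone hv hθ0) (by linarith) (by simpa using hz)
  rw [Metric.mem_ball] at hzρ ⊢
  have h1 := dist_triangle (z + θ * v) z (γ j t₀)
  rw [dist_self_add_left] at h1
  linarith

/-- A uniform interior cone condition at scale `r`: near every point of `D` close to the
complement there is a direction `n` in which balls of comparable radius stay in `D`. -/
def UniformConeCondition (D : Set ℂ) (r : ℝ) : Prop :=
  ∀ z ∈ D, Metric.infDist z Dᶜ < r → ∃ n : ℂ, ‖n‖ = 1 ∧ ∀ z' ∈ D, dist z' z < r →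
    ∀ s : ℝ, 0 < s → s ≤ r → Metric.ball (z' + s * n) (s / 2) ⊆ D

lemma nonempty_compl_of_isBounded {D : Set ℂ} (hDb : Bornology.IsBounded D) : (Dᶜ).Nonempty := by
  rw [nonempty_compl]
  rintro rfl
  exact NoncompactSpace.noncompact_univ (X := ℂ) (by simpa using hDb.isCompact_closure)

lemma exists_frontier_dist_lt (hD : IsOpen D) (hne : (Dᶜ).Nonempty) {z : ℂ} (hz : z ∈ D) {r : ℝ}
    (hr : Metric.infDist z Dᶜ < r) : ∃ p ∈ frontier D, dist z p < r := by
  obtain ⟨y, hy, hyr⟩ := (Metric.infDist_lt_iff hne).1 hr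
  by_contra! hcon
  have hd : ∀ x ∈ Metric.ball z r, x ∉ frontier D := fun x hx hx' =>
    absurd (hcon x hx') (not_le.2 (by rwa [dist_comm]))
  rw [hD.frontier_eq] at hd
  have hr0 : 0 < r := Metric.infDist_nonneg.trans_lt hr
  obtain ⟨x, -, hx, hx'⟩ := Metric.isPreconnected_ball (x := z) (r := r) D (closure D)ᶜ hD
    isClosed_closure.isOpen_compl (fun x hx => by
      by_contra h
      simp only [mem_union, mem_compl_iff, not_or, not_not] at h
      exact hd x hx ⟨h.2, h.1⟩) ⟨z, Metric.mem_ball_self hr0, hz⟩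
    ⟨y, by rwa [Metric.mem_ball, dist_comm], fun h => hd y (by rwa [Metric.mem_ball, dist_comm]) ⟨h, hy⟩⟩
  exact hx' (subset_closure hx)

theorem IsC1HolderBoundary.exists_uniformConeCondition (h : IsC1HolderBoundary α D γ)
    (hD : IsOpen D) (hDc : IsConnected D) (hDb : Bornology.IsBounded D) :
    ∃ r > 0, UniformConeCondition D r := by
  have hloc : ∀ p : frontier D, ∃ ρ > 0, ∃ τ : ℂ, τ ≠ 0 ∧ ∀ z ∈ D, z ∈ Metric.ball (p : ℂ) ρ →
      ∀ v ∈ leftCone τ, ‖v‖ < ρ → z + v ∈ D := by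
    rintro ⟨p, hp⟩
    rw [h.frontier_eq, mem_iUnion] at hp
    obtain ⟨j, t₀, rfl⟩ := hp
    obtain ⟨ρ, hρ, H⟩ := h.exists_add_mem hD hDc j t₀
    exact ⟨ρ, hρ, _, h.deriv_ne_zero j t₀, H⟩
  choose ρ hρ τ hτ H using hloc
  have hcpt : IsCompact (frontier D) :=
    Metric.isCompact_of_isClosed_isBounded isClosed_frontier
      (hDb.closure.subset frontier_subset_closure)
  obtain ⟨t, ht⟩ := hcpt.elim_nhds_subcover' (fun p hp => Metric.ball p (ρ ⟨p, hp⟩ / 2))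
    fun p hp => Metric.ball_mem_nhds _ (half_pos (hρ ⟨p, hp⟩))
  obtain ⟨r, hr, hrt⟩ : ∃ r > 0, ∀ p ∈ t, r ≤ ρ p / 4 := by
    rcases t.eq_empty_or_nonempty with rfl | hne
    · exact ⟨1, one_pos, by simp⟩
    · obtain ⟨p, -, hp⟩ := t.exists_min_image ρ hne
      exact ⟨ρ p / 4, by linarith [hρ p], fun q hq => by linarith [hp q hq]⟩
  have hne : (Dᶜ).Nonempty := nonempty_compl_of_isBounded hDb
  refine ⟨r, hr, fun z hz hzr => ?_⟩
  obtain ⟨p, hp, hzp⟩ := exists_frontier_dist_lt hD hne hz hzr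
  obtain ⟨q, hq, hpq⟩ := mem_iUnion₂.1 (ht hp)
  set n := Complex.I * τ q / ‖τ q‖ with hn
  have hn1 : ‖n‖ = 1 := by
    rw [norm_div, norm_mul, Complex.norm_I, one_mul, Complex.norm_real, norm_norm,
      div_self (norm_ne_zero_iff.2 (hτ q))]
  refine ⟨n, hn1, fun z' hz' hzz' s hs hsr x hx => ?_⟩
  · have hrq := hrt q hq
    rw [Metric.mem_ball] at hpq hx
    have h1 : z' ∈ Metric.ball (q : ℂ) (ρ q) := by
      rw [Metric.mem_ball]
      have := dist_triangle4 z' z p q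
      linarith
    have hx' : ‖(x - z') - s * n‖ < s / 2 := by
      rw [dist_eq_norm] at hx
      rwa [sub_sub]
    have h2 := H q z' hz' h1 (x - z') (ball_subset_leftCone (hτ q) hx') (by
      have := norm_le_norm_sub_add (x - z') (s * n)
      rw [norm_mul, hn1, Complex.norm_real, Real.norm_of_nonneg hs.le] at this
      linarith [hρ q])
    simpa using h2

end ConeCondition

/-! ### Arc length on the boundary -/

section BoundaryMeasure

open Set Filter MeasureTheory

/-- A regular `C¹` curve is bi-Lipschitz with comparable constants on short parameter intervals. -/
lemma exists_biLipschitz_partition {γ : ℝ → ℂ} (hγ : ContDiff ℝ 1 γ) (h0 : ∀ t, deriv γ t ≠ 0) :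
    ∃ n : ℕ, 0 < n ∧ ∀ i < n, ∃ m : ℝ, 0 < m ∧
      ∀ s ∈ Ico (i / n : ℝ) ((i + 1) / n), ∀ t ∈ Ico (i / n : ℝ) ((i + 1) / n),
        m * |s - t| ≤ ‖γ s - γ t‖ ∧ ‖γ s - γ t‖ ≤ 2 * m * |s - t| ∧ ‖deriv γ t‖ ≤ 2 * m := by
  choose η hη hη1 hη2 using fun t₀ => exists_forall_norm_sub_le hγ (h0 t₀)
  obtain ⟨δ, hδ, hb⟩ := lebesgue_number_lemma_of_metric (s := Icc (0 : ℝ) 1)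
    (c := fun x => Metric.ball x (η x)) isCompact_Icc (fun _ => Metric.isOpen_ball)
    (fun x _ => mem_iUnion.2 ⟨x, Metric.mem_ball_self (hη x)⟩)
  obtain ⟨k, hk⟩ := exists_nat_one_div_lt hδ
  refine ⟨k + 1, k.succ_pos, fun i hi => ?_⟩
  have hk0 : (0 : ℝ) < k + 1 := by positivity
  obtain ⟨x, hx⟩ := hb (i / (k + 1 : ℕ) : ℝ) ⟨by positivity, by
    rw [div_le_one (by positivity)]
    exact_mod_cast hi.le⟩
  have hsub : ∀ t ∈ Ico (i / (k + 1 : ℕ) : ℝ) ((i + 1) / (k + 1 : ℕ)), t ∈ Metric.ball x (η x) := by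
    intro t ht
    refine hx ?_
    rw [add_div, mem_Ico] at ht
    push_cast at ht ⊢
    rw [Metric.mem_ball, Real.dist_eq, abs_lt]
    constructor <;> linarith [ht.1, ht.2]
  have hτ := norm_pos_iff.2 (h0 x)
  refine ⟨3 / 4 * ‖deriv γ x‖, by positivity, fun s hs t ht => ?_⟩
  have h1 := hη1 x s (hsub s hs) t (hsub t ht)
  have h2 := hη2 x t (hsub t ht)
  have h3 : ‖((s - t : ℝ) : ℂ) * deriv γ x‖ = |s - t| * ‖deriv γ x‖ := by
    rw [norm_mul, Complex.norm_real, Real.norm_eq_abs]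
  have h4 := abs_le.1 ((abs_norm_sub_norm_le _ _).trans h1)
  have h5 := abs_le.1 ((abs_norm_sub_norm_le _ _).trans h2)
  rw [h3] at h4
  have h6 := mul_nonneg (abs_nonneg (s - t)) hτ.le
  refine ⟨?_, ?_, ?_⟩ <;> nlinarith

lemma Ico_eq_biUnion_partition {n : ℕ} (hn : 0 < n) :
    Ico (0 : ℝ) 1 = ⋃ i ∈ Finset.range n, Ico (i / n : ℝ) ((i + 1) / n) := by
  have hn' : (0 : ℝ) < n := by exact_mod_cast hn
  ext t
  simp only [mem_Ico, Finset.mem_range, mem_iUnion, exists_prop, div_le_iff₀ hn', lt_div_iff₀ hn']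
  constructor
  · rintro ⟨h1, h2⟩
    refine ⟨⌊t * n⌋₊, ?_, Nat.floor_le (by positivity), Nat.lt_floor_add_one _⟩
    rw [Nat.floor_lt (by positivity)]
    nlinarith
  · rintro ⟨i, hi, h1, h2⟩
    have hi' : (i : ℝ) + 1 ≤ n := by exact_mod_cast hi
    have : (0 : ℝ) ≤ i := by positivity
    constructor
    · by_contra h
      nlinarith
    · by_contra h
      nlinarith

lemma disjoint_partition {n : ℕ} (hn : 0 < n) {i j : ℕ} (hij : i ≠ j) :
    Disjoint (Ico (i / n : ℝ) ((i + 1) / n)) (Ico (j / n : ℝ) ((j + 1) / n)) := by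
  have hn' : (0 : ℝ) < n := by exact_mod_cast hn
  refine disjoint_left.2 fun t h1 h2 => hij ?_
  simp only [mem_Ico, div_le_iff₀ hn', lt_div_iff₀ hn'] at h1 h2
  have a : i < j + 1 := by exact_mod_cast h1.1.trans_lt h2.2
  have b : j < i + 1 := by exact_mod_cast h2.1.trans_lt h1.2
  omega

/-- The length of a regular arc is at most twice the one-dimensional Hausdorff measure of its
image; on short arcs this compares `γ` with its inverse. -/
lemma lintegral_enorm_deriv_le_hausdorffMeasure {γ : ℝ → ℂ} (hγ : ContDiff ℝ 1 γ)
    (h0 : ∀ t, deriv γ t ≠ 0) (hi : InjOn γ (Ico 0 1)) {A : Set ℝ} (hA : MeasurableSet A)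
    (hA1 : A ⊆ Ico 0 1) :
    ∫⁻ t in A, ‖deriv γ t‖ₑ ≤ 2 * Measure.hausdorffMeasure 1 (γ '' A) := by
  obtain ⟨n, hn, hp⟩ := exists_biLipschitz_partition hγ h0
  set I : ℕ → Set ℝ := fun i => Ico (i / n : ℝ) ((i + 1) / n) with hI
  have hAU : A = ⋃ i ∈ Finset.range n, A ∩ I i := by
    rw [← inter_iUnion₂, ← Ico_eq_biUnion_partition hn, inter_eq_left.2 hA1]
  have hAm : ∀ i, MeasurableSet (A ∩ I i) := fun i => hA.inter measurableSet_Ico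
  have hdis : ∀ i j, i ≠ j → Disjoint (A ∩ I i) (A ∩ I j) := fun i j hij =>
    (disjoint_partition hn hij).mono inter_subset_right inter_subset_right
  have hpiece : ∀ i ∈ Finset.range n, ∫⁻ t in A ∩ I i, ‖deriv γ t‖ₑ ≤
      2 * Measure.hausdorffMeasure 1 (γ '' (A ∩ I i)) := by
    intro i hin
    obtain ⟨m, hm, hb⟩ := hp i (Finset.mem_range.1 hin)
    have hinj : InjOn γ (A ∩ I i) := hi.mono (inter_subset_left.trans hA1)
    have hlip : LipschitzOnWith (Real.toNNReal m⁻¹) (Function.invFunOn γ (A ∩ I i))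
        (γ '' (A ∩ I i)) := by
      refine LipschitzOnWith.of_dist_le_mul ?_
      rintro _ ⟨s, hs, rfl⟩ _ ⟨t, ht, rfl⟩
      rw [hinj.leftInvOn_invFunOn hs, hinj.leftInvOn_invFunOn ht,
        Real.coe_toNNReal _ (by positivity), inv_mul_eq_div, le_div_iff₀ hm, Real.dist_eq,
        dist_eq_norm, mul_comm]
      exact (hb s hs.2 t ht.2).1
    have h1 := hlip.hausdorffMeasure_image_le zero_le_one
    rw [hinj.leftInvOn_invFunOn.image_image, hausdorffMeasure_real, ENNReal.rpow_one] at h1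
    calc ∫⁻ t in A ∩ I i, ‖deriv γ t‖ₑ ≤ ∫⁻ t in A ∩ I i, ENNReal.ofReal (2 * m) := by
          refine setLIntegral_mono' (hAm i) fun t ht => ?_
          rw [← ofReal_norm]
          exact ENNReal.ofReal_le_ofReal (hb t ht.2 t ht.2).2.2
      _ = ENNReal.ofReal (2 * m) * volume (A ∩ I i) := setLIntegral_const _ _
      _ ≤ ENNReal.ofReal (2 * m) * (ENNReal.ofReal m⁻¹ *
            Measure.hausdorffMeasure 1 (γ '' (A ∩ I i))) := by
          gcongr
          exact h1
      _ = 2 * Measure.hausdorffMeasure 1 (γ '' (A ∩ I i)) := by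
          rw [← mul_assoc, ← ENNReal.ofReal_mul (by positivity), mul_assoc, mul_inv_cancel₀ hm.ne',
            mul_one, ENNReal.ofReal_ofNat]
  calc ∫⁻ t in A, ‖deriv γ t‖ₑ = ∫⁻ t in ⋃ i ∈ Finset.range n, A ∩ I i, ‖deriv γ t‖ₑ := by
        rw [← hAU]
    _ = ∑ i ∈ Finset.range n, ∫⁻ t in A ∩ I i, ‖deriv γ t‖ₑ :=
        lintegral_biUnion_finset (fun i _ j _ hij => hdis i j hij) (fun i _ => hAm i) _
    _ ≤ ∑ i ∈ Finset.range n, 2 * Measure.hausdorffMeasure 1 (γ '' (A ∩ I i)) :=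
        Finset.sum_le_sum hpiece
    _ = 2 * Measure.hausdorffMeasure 1 (⋃ i ∈ Finset.range n, γ '' (A ∩ I i)) := by
        rw [← Finset.mul_sum, measure_biUnion_finset]
        · intro i _ j _ hij
          exact (hdis i j hij).image hi (inter_subset_left.trans hA1) (inter_subset_left.trans hA1)
        · exact fun i _ => (hAm i).image_of_continuousOn_injOn hγ.continuous.continuousOn
            (hi.mono (inter_subset_left.trans hA1))
    _ = 2 * Measure.hausdorffMeasure 1 (γ '' A) := by
        rw [← image_iUnion₂, ← hAU]

lemma exists_hausdorffMeasure_arc_le {γ : ℝ → ℂ} (hγ : ContDiff ℝ 1 γ) (h0 : ∀ t, deriv γ t ≠ 0) :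
    ∃ A : ℝ≥0, ∀ (z : ℂ) (r : ℝ), 0 < r →
      Measure.hausdorffMeasure 1 (γ '' Ico 0 1 ∩ Metric.ball z r) ≤ A * ENNReal.ofReal r := by
  obtain ⟨n, hn, hp⟩ := exists_biLipschitz_partition hγ h0
  refine ⟨n * 4, fun z r hr => ?_⟩
  set I : ℕ → Set ℝ := fun i => Ico (i / n : ℝ) ((i + 1) / n) with hI
  have hsub : γ '' Ico 0 1 ∩ Metric.ball z r ⊆
      ⋃ i ∈ Finset.range n, γ '' (I i ∩ γ ⁻¹' Metric.ball z r) := by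
    rw [Ico_eq_biUnion_partition hn]
    rintro _ ⟨⟨t, ht, rfl⟩, htz⟩
    obtain ⟨i, hi, ht⟩ := mem_iUnion₂.1 ht
    exact mem_iUnion₂.2 ⟨i, hi, mem_image_of_mem γ ⟨ht, htz⟩⟩
  have hpiece : ∀ i ∈ Finset.range n,
      Measure.hausdorffMeasure 1 (γ '' (I i ∩ γ ⁻¹' Metric.ball z r)) ≤ 4 * ENNReal.ofReal r := by
    intro i hin
    obtain ⟨m, hm, hb⟩ := hp i (Finset.mem_range.1 hin)
    have hlip : LipschitzOnWith (Real.toNNReal (2 * m)) γ (I i ∩ γ ⁻¹' Metric.ball z r) := by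
      refine LipschitzOnWith.of_dist_le_mul fun s hs t ht => ?_
      rw [Real.coe_toNNReal _ (by positivity), dist_eq_norm, Real.dist_eq]
      exact (hb s hs.1 t ht.1).2.1
    have h1 := hlip.hausdorffMeasure_image_le zero_le_one
    rw [hausdorffMeasure_real, ENNReal.rpow_one] at h1
    have h2 : volume (I i ∩ γ ⁻¹' Metric.ball z r) ≤ ENNReal.ofReal (2 * r / m) := by
      refine (Real.volume_le_diam _).trans (Metric.ediam_le fun s hs t ht => ?_)
      rw [edist_dist]
      refine ENNReal.ofReal_le_ofReal ?_
      rw [le_div_iff₀ hm, Real.dist_eq, mul_comm]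
      refine (hb s hs.1 t ht.1).1.trans ?_
      have h3 := hs.2
      have h4 := ht.2
      rw [mem_preimage, Metric.mem_ball] at h3 h4
      rw [← dist_eq_norm]
      linarith [dist_triangle_right (γ s) (γ t) z]
    calc _ ≤ _ := h1
      _ ≤ ENNReal.ofReal (2 * m) * ENNReal.ofReal (2 * r / m) := by
        gcongr
        exact le_rfl
      _ = 4 * ENNReal.ofReal r := by
        rw [← ENNReal.ofReal_mul (by positivity),
          show 2 * m * (2 * r / m) = 4 * r by field_simp; norm_num, ENNReal.ofReal_mul (by norm_num),
          ENNReal.ofReal_ofNat]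
  calc _ ≤ _ := measure_mono hsub
    _ ≤ ∑ i ∈ Finset.range n, Measure.hausdorffMeasure 1 (γ '' (I i ∩ γ ⁻¹' Metric.ball z r)) :=
      measure_biUnion_finset_le _ _
    _ ≤ ∑ i ∈ Finset.range n, 4 * ENNReal.ofReal r := Finset.sum_le_sum hpiece
    _ = _ := by
      simp [mul_assoc]

/-- The arc length measure of a family of closed curves of period `1`, as a measure on `ℂ`. -/
noncomputable def arcLengthMeasure {N : ℕ} (γ : Fin N → ℝ → ℂ) : Measure ℂ :=
  ∑ j, ((volume.restrict (Ico 0 1)).withDensity fun t => ‖deriv (γ j) t‖ₑ).map (γ j)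

lemma lintegral_arcLengthMeasure {N : ℕ} {γ : Fin N → ℝ → ℂ} (hγ : ∀ j, ContDiff ℝ 1 (γ j))
    {g : ℂ → ℝ≥0∞} (hg : Measurable g) :
    ∫⁻ ζ, g ζ ∂(arcLengthMeasure γ) =
      ∑ j, ∫⁻ t in Ico (0 : ℝ) 1, g (γ j t) * ‖deriv (γ j) t‖ₑ := by
  rw [arcLengthMeasure, lintegral_finsetSum_measure]
  refine Finset.sum_congr rfl fun j _ => ?_
  have hm := (hγ j).continuous.measurable
  rw [lintegral_map hg hm]
  refine (lintegral_withDensity_eq_lintegral_mul (volume.restrict (Ico 0 1))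
    ((hγ j).continuous_deriv le_rfl).enorm.measurable (hg.comp hm)).trans ?_
  simp only [Pi.mul_apply, Function.comp, mul_comm]

variable {α : ℝ} {D : Set ℂ} {N : ℕ} {γ : Fin N → ℝ → ℂ}

/-- The arc length measure of any boundary parametrization is controlled by the Hausdorff measure
on `∂D`, with a constant that does not depend on the parametrization. -/
lemma IsC1HolderBoundary.arcLengthMeasure_le (h : IsC1HolderBoundary α D γ) {E : Set ℂ}
    (hE : MeasurableSet E) :
    arcLengthMeasure γ E ≤ 2 * Measure.hausdorffMeasure 1 (frontier D ∩ E) := by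
  have hm : ∀ j, MeasurableSet (Ico (0 : ℝ) 1 ∩ γ j ⁻¹' E) := fun j =>
    measurableSet_Ico.inter ((h.contDiff j).continuous.measurable hE)
  have h1 : arcLengthMeasure γ E = ∑ j, ∫⁻ t in Ico (0 : ℝ) 1 ∩ γ j ⁻¹' E, ‖deriv (γ j) t‖ₑ := by
    rw [← lintegral_indicator_one hE,
      lintegral_arcLengthMeasure h.contDiff (measurable_one.indicator hE)]
    refine Finset.sum_congr rfl fun j _ => ?_
    rw [inter_comm, ← setLIntegral_indicator ((h.contDiff j).continuous.measurable hE)]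
    congr 1
    ext t
    by_cases ht : γ j t ∈ E <;> simp [indicator, ht]
  rw [h1]
  calc _ ≤ ∑ j, 2 * Measure.hausdorffMeasure 1 (γ j '' (Ico (0 : ℝ) 1 ∩ γ j ⁻¹' E)) :=
        Finset.sum_le_sum fun j _ => lintegral_enorm_deriv_le_hausdorffMeasure (h.contDiff j)
          (h.deriv_ne_zero j) (h.injOn j) (hm j) inter_subset_left
    _ = 2 * Measure.hausdorffMeasure 1 (⋃ j, γ j '' (Ico (0 : ℝ) 1 ∩ γ j ⁻¹' E)) := by
        rw [← Finset.mul_sum, measure_iUnion, tsum_fintype]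
        · intro i j hij
          exact (h.pairwise_disjoint i j hij).mono (image_subset_range _ _) (image_subset_range _ _)
        · exact fun j => (hm j).image_of_continuousOn_injOn
            (h.contDiff j).continuous.continuousOn ((h.injOn j).mono inter_subset_left)
    _ ≤ _ := by
        gcongr
        refine iUnion_subset fun j => ?_
        rintro _ ⟨t, ht, rfl⟩
        refine ⟨?_, ht.2⟩
        rw [h.frontier_eq]
        exact mem_iUnion.2 ⟨j, mem_range_self t⟩

lemma IsC1HolderBoundary.exists_hausdorffMeasure_frontier_le (h : IsC1HolderBoundary α D γ) :
    ∃ A : ℝ≥0, ∀ (z : ℂ) (r : ℝ), 0 < r →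
      Measure.hausdorffMeasure 1 (frontier D ∩ Metric.ball z r) ≤ A * ENNReal.ofReal r := by
  choose A hA using fun j => exists_hausdorffMeasure_arc_le (h.contDiff j) (h.deriv_ne_zero j)
  refine ⟨∑ j, A j, fun z r hr => ?_⟩
  have hsub : frontier D ∩ Metric.ball z r ⊆ ⋃ j, γ j '' Ico 0 1 ∩ Metric.ball z r := by
    rw [h.frontier_eq, iUnion_inter]
    refine iUnion_mono fun j => inter_subset_inter_left _ ?_
    rintro _ ⟨t, rfl⟩
    obtain ⟨s, hs, hst⟩ := (h.periodic j).exists_mem_Ico one_pos t 0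
    rw [zero_add] at hs
    exact ⟨s, hs, hst.symm⟩
  calc _ ≤ _ := measure_mono hsub
    _ ≤ ∑ j, Measure.hausdorffMeasure 1 (γ j '' Ico 0 1 ∩ Metric.ball z r) :=
      measure_iUnion_fintype_le _ _
    _ ≤ ∑ j, A j * ENNReal.ofReal r := Finset.sum_le_sum fun j _ => hA j z r hr
    _ = _ := by
      push_cast
      rw [Finset.sum_mul]

/-- Upper Ahlfors regularity of arc length on `∂D`, uniformly in the parametrization: the constant
is found with one parametrization `γ₀` and serves all the others. -/
theorem IsC1HolderBoundary.exists_arcLengthMeasure_ball_le {β : ℝ} {N₀ : ℕ}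
    {γ₀ : Fin N₀ → ℝ → ℂ} (h₀ : IsC1HolderBoundary β D γ₀) :
    ∃ A : ℝ, 0 < A ∧ ∀ (N : ℕ) (γ : Fin N → ℝ → ℂ), IsC1HolderBoundary α D γ →
      ∀ (z : ℂ) (r : ℝ), 0 < r → arcLengthMeasure γ (Metric.ball z r) ≤ ENNReal.ofReal (A * r) := by
  obtain ⟨A, hA⟩ := h₀.exists_hausdorffMeasure_frontier_le
  refine ⟨2 * (A + 1), by positivity, fun N γ h z r hr => ?_⟩
  refine (h.arcLengthMeasure_le Metric.isOpen_ball.measurableSet).trans ?_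
  rw [mul_assoc, ENNReal.ofReal_mul (by norm_num), ENNReal.ofReal_ofNat]
  gcongr
  refine (hA z r hr).trans ?_
  rw [ENNReal.ofReal_mul (by positivity)]
  gcongr
  rw [← ENNReal.ofReal_coe_nnreal]
  exact ENNReal.ofReal_le_ofReal (by linarith)

end BoundaryMeasure

/-! ### From a gradient bound to a modulus of continuity -/

section GradientToModulus

open Set Filter Metric

/-- A positive gauge `Ω` on `(0, ∞)` growing at most linearly and at least like the power `a`, up to
the factor `K`. -/
structure IsGrowthGauge (Ω : ℝ → ℝ) (K a : ℝ) : Prop where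
  one_le : 1 ≤ K
  exponent_pos : 0 < a
  pos : ∀ r, 0 < r → 0 < Ω r
  mul_le : ∀ r l, 0 < r → 1 ≤ l → Ω (l * r) ≤ K * l * Ω r
  le_mul : ∀ r l, 0 < r → 1 ≤ l → Ω r ≤ K * l ^ (-a) * Ω (l * r)

lemma IsGrowthGauge.le_of_le {Ω : ℝ → ℝ} {K a : ℝ} (h : IsGrowthGauge Ω K a) {r s : ℝ} (hr : 0 < r)
    (hrs : r ≤ s) : Ω r ≤ K * Ω s := by
  have hl : 1 ≤ s / r := (one_le_div hr).2 hrs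
  have h1 := h.le_mul r (s / r) hr hl
  rw [div_mul_cancel₀ _ hr.ne'] at h1
  refine h1.trans ?_
  have h2 : (s / r) ^ (-a) ≤ 1 := Real.rpow_le_one_of_one_le_of_nonpos hl (by linarith [h.exponent_pos])
  have h3 := h.pos s (hr.trans_le hrs)
  have h4 := h.one_le
  gcongr
  nlinarith

lemma IsGrowthGauge.div_le_div {Ω : ℝ → ℝ} {K a : ℝ} (h : IsGrowthGauge Ω K a) {r s : ℝ} (hr : 0 < r)
    (hrs : r ≤ s) : Ω s / s ≤ K * (Ω r / r) := by
  have h1 := h.mul_le r (s / r) hr ((one_le_div hr).2 hrs)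
  rw [div_mul_cancel₀ _ hr.ne'] at h1
  have hs := hr.trans_le hrs
  rw [div_le_iff₀ hs]
  calc Ω s ≤ _ := h1
    _ = _ := by field_simp

/-- `F` is differentiable on `D` with `|F'(z)| ≤ M Ω(δ) / δ`, where `δ` is the distance of `z` to
the complement of `D`. -/
def GradientBound (D : Set ℂ) (Ω : ℝ → ℝ) (M : ℝ) (F : ℂ → ℂ) : Prop :=
  ∀ z ∈ D, ∃ F' : ℂ, HasDerivAt F F' z ∧ ‖F'‖ ≤ M * (Ω (infDist z Dᶜ) / infDist z Dᶜ)

variable {D : Set ℂ} {Ω : ℝ → ℝ} {K a M r : ℝ} {F : ℂ → ℂ}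

lemma mem_of_infDist_compl_pos {z : ℂ} (h : 0 < infDist z Dᶜ) : z ∈ D := by
  by_contra hz
  exact h.ne' (infDist_zero_of_mem hz)

lemma GradientBound.norm_sub_le_of_segment (hΩ : IsGrowthGauge Ω K a) (hM : 0 ≤ M)
    (hF : GradientBound D Ω M F) {x y : ℂ} {d : ℝ} (hd : 0 < d)
    (hseg : ∀ w ∈ segment ℝ x y, d ≤ infDist w Dᶜ) :
    ‖F y - F x‖ ≤ M * (K * (Ω d / d)) * ‖y - x‖ := by
  choose! F' hF' hb using hF
  have hmem : ∀ w ∈ segment ℝ x y, w ∈ D := fun w hw =>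
    mem_of_infDist_compl_pos (hd.trans_le (hseg w hw))
  refine (convex_segment x y).norm_image_sub_le_of_norm_hasDerivWithin_le (f' := F')
    (fun w hw => (hF' w (hmem w hw)).hasDerivWithinAt) (fun w hw => (hb w (hmem w hw)).trans ?_)
    (left_mem_segment ℝ x y) (right_mem_segment ℝ x y)
  gcongr
  exact hΩ.div_le_div hd (hseg w hw)

lemma GradientBound.norm_sub_le_of_interior (hΩ : IsGrowthGauge Ω K a) (hM : 0 ≤ M)
    (hF : GradientBound D Ω M F) {x y : ℂ} {h : ℝ} (hh : 0 < h) (hxy : ‖y - x‖ ≤ h)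
    (hx : 2 * h ≤ infDist x Dᶜ) :
    ‖F y - F x‖ ≤ K * M * Ω h := by
  have h1 : ∀ w ∈ segment ℝ x y, h ≤ infDist w Dᶜ := by
    intro w hw
    have h2 : dist x w ≤ h := by
      have := (convex_closedBall x h).segment_subset (mem_closedBall_self hh.le)
        (by rwa [mem_closedBall, dist_eq_norm]) hw
      rwa [mem_closedBall, dist_comm] at this
    have h3 := infDist_le_infDist_add_dist (s := Dᶜ) (x := x) (y := w)
    linarith
  refine (hF.norm_sub_le_of_segment hΩ hM hh h1).trans ?_
  have h4 := hΩ.pos h hh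
  have h5 := hΩ.one_le
  calc _ ≤ M * (K * (Ω h / h)) * h := by gcongr
    _ = _ := by field_simp

/-- Moving from `z` into `D` along the axis of a cone: the increments over dyadic steps form a
geometric series. -/
lemma GradientBound.norm_sub_le_of_cone (hΩ : IsGrowthGauge Ω K a) (hM : 0 ≤ M)
    (hne : (Dᶜ).Nonempty) (hF : GradientBound D Ω M F) {z n : ℂ} (hz : z ∈ D) (hn : ‖n‖ = 1) {s : ℝ}
    (hs : 0 < s) (hball : ∀ σ : ℝ, 0 < σ → σ ≤ s → ball (z + σ * n) (σ / 2) ⊆ D) :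
    ‖F (z + s * n) - F z‖ ≤ 2 * K ^ 3 * (1 - 2 ^ (-a))⁻¹ * M * Ω s := by
  have hK := hΩ.one_le
  have hfar : ∀ σ : ℝ, 0 < σ → σ ≤ s → σ / 2 ≤ infDist (z + σ * n) Dᶜ := by
    intro σ h0 h1
    rw [le_infDist hne]
    intro y hy
    by_contra h
    exact hy (hball σ h0 h1 (by rw [mem_ball, dist_comm]; linarith))
  have hstep : ∀ σ : ℝ, 0 < σ → σ ≤ s →
      ‖F (z + σ * n) - F (z + (σ / 2 : ℝ) * n)‖ ≤ 2 * K ^ 2 * M * Ω σ := by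
    intro σ h0 h1
    have hseg : ∀ w ∈ segment ℝ (z + (σ / 2 : ℝ) * n) (z + σ * n), σ / 4 ≤ infDist w Dᶜ := by
      rintro w ⟨p, q, hp, hq, hpq, rfl⟩
      have h2 : p • (z + ((σ / 2 : ℝ) : ℂ) * n) + q • (z + (σ : ℂ) * n) =
          z + ((p * (σ / 2) + q * σ : ℝ) : ℂ) * n := by
        simp only [Complex.real_smul]
        push_cast
        have : (p : ℂ) + q = 1 := by exact_mod_cast hpq
        linear_combination z * this
      have h3 : σ / 2 ≤ p * (σ / 2) + q * σ := by
        have : p = 1 - q := by linarith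
        subst this
        nlinarith
      have h4 : p * (σ / 2) + q * σ ≤ σ := by
        have : q = 1 - p := by linarith
        subst this
        nlinarith
      rw [h2]
      have := hfar _ (by linarith) (h4.trans h1)
      linarith
    have h2 := hF.norm_sub_le_of_segment hΩ hM (by linarith) hseg
    have h3 : ‖z + (σ : ℂ) * n - (z + ((σ / 2 : ℝ) : ℂ) * n)‖ = σ / 2 := by
      have : z + (σ : ℂ) * n - (z + ((σ / 2 : ℝ) : ℂ) * n) = ((σ / 2 : ℝ) : ℂ) * n := by
        push_cast
        ring
      rw [this, norm_mul, hn, mul_one, Complex.norm_real, Real.norm_of_nonneg (by linarith)]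
    rw [h3] at h2
    have h4 : Ω (σ / 4) ≤ K * Ω σ := hΩ.le_of_le (by linarith) (by linarith)
    calc _ ≤ _ := h2
      _ ≤ M * (K * (K * Ω σ / (σ / 4))) * (σ / 2) := by gcongr
      _ = _ := by field_simp; ring
  have hq0 : (0 : ℝ) < 2 ^ (-a) := by positivity
  have hq1 : (2 : ℝ) ^ (-a) < 1 :=
    Real.rpow_lt_one_of_one_lt_of_neg one_lt_two (by linarith [hΩ.exponent_pos])
  have hΩs := hΩ.pos s hs
  have hsum : ∀ k : ℕ, ‖F (z + s * n) - F (z + (s / 2 ^ k : ℝ) * n)‖ ≤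
      ∑ i ∈ Finset.range k, 2 * K ^ 3 * M * Ω s * (2 ^ (-a)) ^ i := by
    intro k
    induction k with
    | zero => simp
    | succ k ih =>
      rw [Finset.sum_range_succ]
      have h2k : (1 : ℝ) ≤ 2 ^ k := one_le_pow₀ one_le_two
      have h1 := hstep (s / 2 ^ k) (by positivity) (div_le_self hs.le h2k)
      rw [div_div, ← pow_succ] at h1
      have h2 := hΩ.le_mul (s / 2 ^ k) (2 ^ k) (by positivity) h2k
      rw [mul_div_cancel₀ _ (by positivity : (2 : ℝ) ^ k ≠ 0), ← Real.rpow_natCast,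
        ← Real.rpow_mul (by norm_num), mul_comm (k : ℝ), Real.rpow_mul (by norm_num),
        Real.rpow_natCast, Real.rpow_natCast] at h2
      have h3 := norm_sub_le_norm_sub_add_norm_sub (F (z + s * n)) (F (z + (s / 2 ^ k : ℝ) * n))
        (F (z + (s / 2 ^ (k + 1) : ℝ) * n))
      have h4 : 2 * K ^ 2 * M * Ω (s / 2 ^ k) ≤ 2 * K ^ 3 * M * Ω s * (2 ^ (-a)) ^ k := by
        calc _ ≤ 2 * K ^ 2 * M * (K * (2 ^ (-a)) ^ k * Ω s) := by gcongr
          _ = _ := by ring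
      linarith
  have hlim : Tendsto (fun k : ℕ => ‖F (z + s * n) - F (z + (s / 2 ^ k : ℝ) * n)‖) atTop
      (𝓝 ‖F (z + s * n) - F z‖) := by
    obtain ⟨F', hF', -⟩ := hF z hz
    have h1 : Tendsto (fun k : ℕ => (s / 2 ^ k : ℝ)) atTop (𝓝 0) := by
      simpa [div_eq_mul_inv] using
        (tendsto_pow_atTop_nhds_zero_of_lt_one (r := (2 : ℝ)⁻¹) (by norm_num) (by norm_num)).const_mul s
    have h2 : Tendsto (fun k : ℕ => z + ((s / 2 ^ k : ℝ) : ℂ) * n) atTop (𝓝 z) := by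
      have hc : Continuous fun x : ℝ => z + (x : ℂ) * n := by fun_prop
      have h3 := (hc.tendsto 0).comp h1
      rwa [Complex.ofReal_zero, zero_mul, add_zero] at h3
    exact ((hF'.continuousAt.tendsto.comp h2).const_sub _).norm
  refine le_of_tendsto' hlim fun k => (hsum k).trans ?_
  rw [← Finset.mul_sum]
  have hg : ∑ i ∈ Finset.range k, ((2 : ℝ) ^ (-a)) ^ i ≤ (1 - 2 ^ (-a))⁻¹ := by
    rw [← tsum_geometric_of_lt_one hq0.le hq1]
    exact (summable_geometric_of_lt_one hq0.le hq1).sum_le_tsum _ fun i _ => by positivity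
  calc _ ≤ 2 * K ^ 3 * M * Ω s * (1 - 2 ^ (-a))⁻¹ := by gcongr
    _ = _ := by ring

/-- Hardy–Littlewood principle: in a domain with a uniform cone condition, a gradient bound
`Ω(δ) / δ` integrates to the modulus of continuity `Ω`. -/
theorem exists_modulus_of_gradientBound (hΩ : IsGrowthGauge Ω K a) (hne : (Dᶜ).Nonempty)
    (hr : 0 < r) (hcone : UniformConeCondition D r) :
    ∃ C : ℝ, 0 < C ∧ ∀ (F : ℂ → ℂ) (M : ℝ), 0 ≤ M → GradientBound D Ω M F →
      (∀ z ∈ D, r / 2 ≤ infDist z Dᶜ → ‖F z‖ ≤ M) →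
      (∀ z ∈ D, ‖F z‖ ≤ C * M) ∧
      ∀ z ∈ D, ∀ w ∈ D, 0 < ‖w - z‖ → ‖F w - F z‖ ≤ C * M * Ω ‖w - z‖ := by
  have hK := hΩ.one_le
  have hq1 : (2 : ℝ) ^ (-a) < 1 :=
    Real.rpow_lt_one_of_one_lt_of_neg one_lt_two (by linarith [hΩ.exponent_pos])
  obtain ⟨A, hA0, hA⟩ : ∃ A, 0 < A ∧ A = 2 * K ^ 3 * (1 - 2 ^ (-a))⁻¹ :=
    ⟨_, by have := sub_pos.2 hq1; positivity, rfl⟩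
  have hΩr := hΩ.pos r hr
  have hΩr4 := hΩ.pos (r / 4) (by linarith)
  set S : ℝ := 1 + A * Ω r with hS
  have hS0 : 0 < S := by positivity
  set C₁ : ℝ := 2 * (A * (K * 4)) + K with hC₁
  set C₂ : ℝ := 2 * S * (K / Ω (r / 4)) with hC₂
  have hC₁0 : 0 < C₁ := by positivity
  have hC₂0 : 0 < C₂ := by positivity
  refine ⟨S + C₁ + C₂, by positivity, fun F M hM hF hint => ?_⟩
  have hsup : ∀ z ∈ D, ‖F z‖ ≤ S * M := by
    intro z hz
    rcases le_or_gt (r / 2) (infDist z Dᶜ) with h | h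
    · refine (hint z hz h).trans ?_
      have : 0 ≤ A * Ω r * M := by positivity
      rw [hS]
      linarith
    · obtain ⟨n, hn, hb⟩ := hcone z hz (by linarith)
      have hb' := hb z hz (by rwa [dist_self])
      have h1 := hF.norm_sub_le_of_cone hΩ hM hne hz hn hr hb'
      have h2 : r / 2 ≤ infDist (z + r * n) Dᶜ := by
        rw [le_infDist hne]
        intro y hy
        by_contra h
        exact hy (hb' r hr le_rfl (by rw [mem_ball, dist_comm]; linarith))
      have h3 := hint (z + r * n) (mem_of_infDist_compl_pos (by linarith)) h2
      rw [← hA] at h1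
      have h4 := norm_sub_norm_le (F z) (F (z + r * n))
      rw [norm_sub_rev] at h4
      rw [hS]
      linarith
  refine ⟨fun z hz => (hsup z hz).trans ?_, fun z hz w hw hzw => ?_⟩
  · gcongr
    linarith
  set h := ‖w - z‖ with hh
  have hΩh := hΩ.pos h hzw
  rcases le_or_gt (r / 4) h with hhr | hhr
  · -- distant points
    have h1 : ‖F w - F z‖ ≤ 2 * S * M := by
      linarith [norm_sub_le (F w) (F z), hsup w hw, hsup z hz]
    have h2 : Ω (r / 4) ≤ K * Ω h := hΩ.le_of_le (by linarith) hhr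
    calc ‖F w - F z‖ ≤ 2 * S * M * 1 := by rwa [mul_one]
      _ ≤ 2 * S * M * (K * Ω h / Ω (r / 4)) := by
        gcongr
        rwa [one_le_div hΩr4]
      _ = C₂ * M * Ω h := by rw [hC₂]; ring
      _ ≤ _ := by
        gcongr
        linarith
  · have hC₁' : C₁ * M * Ω h ≤ (S + C₁ + C₂) * M * Ω h := by
      gcongr
      linarith
    refine le_trans ?_ hC₁'
    rcases le_or_gt (2 * h) (infDist z Dᶜ) with hd | hd
    · refine (hF.norm_sub_le_of_interior hΩ hM hzw le_rfl hd).trans ?_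
      gcongr
      rw [hC₁]
      have : 0 < A * (K * 4) := by positivity
      linarith
    · -- up from `z`, across, and down to `w`
      obtain ⟨n, hn, hb⟩ := hcone z hz (by linarith)
      have h4 : (0 : ℝ) < 4 * h := by linarith
      have hbz : ∀ σ : ℝ, 0 < σ → σ ≤ 4 * h → ball (z + σ * n) (σ / 2) ⊆ D := fun σ h0 h1 =>
        hb z hz (by rwa [dist_self]) σ h0 (by linarith)
      have hbw : ∀ σ : ℝ, 0 < σ → σ ≤ 4 * h → ball (w + σ * n) (σ / 2) ⊆ D := fun σ h0 h1 =>
        hb w hw (by rw [dist_eq_norm]; linarith) σ h0 (by linarith)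
      have e1 := hF.norm_sub_le_of_cone hΩ hM hne hz hn h4 hbz
      have e2 := hF.norm_sub_le_of_cone hΩ hM hne hw hn h4 hbw
      have e3 : 2 * h ≤ infDist (z + (4 * h : ℝ) * n) Dᶜ := by
        rw [le_infDist hne]
        intro y hy
        by_contra h'
        exact hy (hbz (4 * h) h4 le_rfl (by rw [mem_ball, dist_comm]; linarith))
      have e4 := hF.norm_sub_le_of_interior hΩ hM hzw (y := w + (4 * h : ℝ) * n)
        (by rw [add_sub_add_right_eq_sub]) e3
      have e5 := hΩ.mul_le h 4 hzw (by norm_num)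
      rw [← hA] at e1 e2
      have e6 : A * M * Ω (4 * h) ≤ A * M * (K * 4 * Ω h) := by gcongr
      have e7 := norm_sub_le_norm_sub_add_norm_sub (F w) (F (w + (4 * h : ℝ) * n)) (F z)
      have e8 := norm_sub_le_norm_sub_add_norm_sub (F (w + (4 * h : ℝ) * n))
        (F (z + (4 * h : ℝ) * n)) (F z)
      rw [norm_sub_rev (F w) (F (w + (4 * h : ℝ) * n))] at e7
      rw [hC₁]
      linarith

end GradientToModulus

/-! ### The continuous extension to the closure -/

section Extension

open Set Filter

variable {D : Set ℂ} {Ω : ℝ → ℝ} {B : ℝ} {f : ℂ → ℂ}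

lemma exists_tendsto_of_modulus (hΩ : Tendsto Ω (𝓝[>] 0) (𝓝 0))
    (hf : ∀ z ∈ D, ∀ w ∈ D, 0 < ‖w - z‖ → ‖f w - f z‖ ≤ B * Ω ‖w - z‖) {ζ : ℂ}
    (hζ : ζ ∈ closure D) : ∃ y, Tendsto f (𝓝[D] ζ) (𝓝 y) := by
  have hne : (𝓝[D] ζ).NeBot := mem_closure_iff_nhdsWithin_neBot.1 hζ
  refine CompleteSpace.complete (Metric.cauchy_iff.2 ⟨hne.map f, fun ε hε => ?_⟩)
  have h1 : Tendsto (fun s => B * Ω s) (𝓝[>] 0) (𝓝 0) := by simpa using hΩ.const_mul B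
  obtain ⟨δ, hδ, hb⟩ := (mem_nhdsGT_iff_exists_Ioo_subset).1 (h1.eventually (gt_mem_nhds hε))
  refine ⟨f '' (D ∩ Metric.ball ζ (δ / 2)), image_mem_map ?_, ?_⟩
  · exact inter_mem self_mem_nhdsWithin
      (mem_nhdsWithin_of_mem_nhds (Metric.ball_mem_nhds _ (half_pos hδ)))
  · rintro _ ⟨x, hx, rfl⟩ _ ⟨y, hy, rfl⟩
    rcases eq_or_ne x y with rfl | hxy
    · rwa [dist_self]
    · have h2 : 0 < ‖x - y‖ := norm_pos_iff.2 (sub_ne_zero.2 hxy)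
      rw [dist_eq_norm]
      refine (hf y hy.1 x hx.1 h2).trans_lt (hb ⟨h2, ?_⟩)
      rw [← dist_eq_norm]
      have h3 := hx.2
      have h4 := hy.2
      rw [Metric.mem_ball] at h3 h4
      linarith [dist_triangle_right x y ζ]

lemma norm_extendFrom_le (hΩ : Tendsto Ω (𝓝[>] 0) (𝓝 0))
    (hf : ∀ z ∈ D, ∀ w ∈ D, 0 < ‖w - z‖ → ‖f w - f z‖ ≤ B * Ω ‖w - z‖)
    (hb : ∀ z ∈ D, ‖f z‖ ≤ B) {ζ : ℂ} (hζ : ζ ∈ closure D) : ‖extendFrom D f ζ‖ ≤ B := by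
  have hne : (𝓝[D] ζ).NeBot := mem_closure_iff_nhdsWithin_neBot.1 hζ
  refine le_of_tendsto (tendsto_extendFrom (exists_tendsto_of_modulus hΩ hf hζ)).norm ?_
  filter_upwards [self_mem_nhdsWithin] with w hw using hb w hw

lemma norm_extendFrom_sub_le (hΩ : Tendsto Ω (𝓝[>] 0) (𝓝 0))
    (hΩc : ∀ r, 0 < r → ContinuousAt Ω r)
    (hf : ∀ z ∈ D, ∀ w ∈ D, 0 < ‖w - z‖ → ‖f w - f z‖ ≤ B * Ω ‖w - z‖) {ζ z : ℂ}
    (hζ : ζ ∈ closure D) (hz : z ∈ D) (hζz : 0 < ‖ζ - z‖) :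
    ‖extendFrom D f ζ - f z‖ ≤ B * Ω ‖ζ - z‖ := by
  have hne : (𝓝[D] ζ).NeBot := mem_closure_iff_nhdsWithin_neBot.1 hζ
  have hc : ContinuousAt (fun w : ℂ => ‖w - z‖) ζ := by fun_prop
  have h1 : Tendsto (fun w => B * Ω ‖w - z‖) (𝓝[D] ζ) (𝓝 (B * Ω ‖ζ - z‖)) :=
    (((hΩc _ hζz).tendsto.comp hc.tendsto).mono_left nhdsWithin_le_nhds).const_mul B
  refine le_of_tendsto_of_tendsto
    ((tendsto_extendFrom (exists_tendsto_of_modulus hΩ hf hζ)).sub_const _).norm h1 ?_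
  filter_upwards [self_mem_nhdsWithin,
    mem_nhdsWithin_of_mem_nhds (hc.eventually (lt_mem_nhds hζz))] with w hw hw'
  exact hf z hz w hw hw'

end Extension

/-! ### The gradient of the Cauchy integral -/

section CauchyIntegral

open Set Filter MeasureTheory

/-- Dyadic estimate of a singular power over an annulus for an upper Ahlfors regular measure. -/
lemma lintegral_annulus_rpow_le {μ : Measure ℂ} {A : ℝ} (z : ℂ)
    (hμ : ∀ r : ℝ, 0 < r → μ (Metric.ball z r) ≤ ENNReal.ofReal (A * r)) {δ κ : ℝ} (hδ : 0 < δ)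
    (hκ : 0 ≤ κ) (hA : 0 ≤ A) (k : ℕ) :
    ∫⁻ ζ in Metric.ball z (2 ^ k * δ) \ Metric.ball z δ, ENNReal.ofReal (‖ζ - z‖ ^ (-1 - κ)) ∂μ ≤
      ENNReal.ofReal (∑ i ∈ Finset.range k, 2 * A * (2 ^ i * δ) ^ (-κ)) := by
  induction k with
  | zero => simp
  | succ k ih =>
    have hρ : (0 : ℝ) < 2 ^ k * δ := by positivity
    have hsub : Metric.ball z (2 ^ (k + 1) * δ) \ Metric.ball z δ ⊆
        (Metric.ball z (2 ^ k * δ) \ Metric.ball z δ) ∪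
          (Metric.ball z (2 ^ (k + 1) * δ) \ Metric.ball z (2 ^ k * δ)) := by
      intro x hx
      by_cases h : x ∈ Metric.ball z (2 ^ k * δ)
      · exact Or.inl ⟨h, hx.2⟩
      · exact Or.inr ⟨hx.1, h⟩
    refine (lintegral_mono_set hsub).trans ((lintegral_union_le _ _ _).trans ?_)
    rw [Finset.sum_range_succ, ENNReal.ofReal_add (Finset.sum_nonneg fun i _ => by positivity)
      (by positivity)]
    gcongr
    calc ∫⁻ ζ in Metric.ball z (2 ^ (k + 1) * δ) \ Metric.ball z (2 ^ k * δ),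
          ENNReal.ofReal (‖ζ - z‖ ^ (-1 - κ)) ∂μ
        ≤ ∫⁻ ζ in Metric.ball z (2 ^ (k + 1) * δ) \ Metric.ball z (2 ^ k * δ),
          ENNReal.ofReal ((2 ^ k * δ) ^ (-1 - κ)) ∂μ := by
          refine setLIntegral_mono' (Metric.isOpen_ball.measurableSet.diff
            Metric.isOpen_ball.measurableSet) fun ζ hζ => ENNReal.ofReal_le_ofReal ?_
          refine Real.rpow_le_rpow_of_nonpos hρ ?_ (by linarith)
          rw [← dist_eq_norm]
          exact not_lt.1 hζ.2
      _ ≤ ENNReal.ofReal ((2 ^ k * δ) ^ (-1 - κ)) * ENNReal.ofReal (A * (2 ^ (k + 1) * δ)) := by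
          rw [setLIntegral_const]
          gcongr
          exact (measure_mono sdiff_subset).trans (hμ _ (by positivity))
      _ = ENNReal.ofReal (2 * A * (2 ^ k * δ) ^ (-κ)) := by
          rw [← ENNReal.ofReal_mul (by positivity)]
          congr 1
          rw [sub_eq_add_neg, Real.rpow_add hρ, Real.rpow_neg_one]
          field_simp
          ring

lemma norm_two_pi_I_inv_le_one : ‖(2 * (Real.pi : ℂ) * Complex.I)⁻¹‖ ≤ 1 := by
  rw [norm_inv, norm_mul, norm_mul, Complex.norm_I, Complex.norm_real,
    Real.norm_of_nonneg Real.pi_pos.le]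
  refine inv_le_one_of_one_le₀ ?_
  have := Real.pi_gt_three
  norm_num
  linarith

lemma enorm_sum_integral_le {N : ℕ} {γ : Fin N → ℝ → ℂ} (hγ : ∀ j, ContDiff ℝ 1 (γ j))
    {g : Fin N → ℝ → ℂ} {G : ℂ → ℝ≥0∞} (hG : Measurable G)
    (hg : ∀ j t, ‖g j t‖ₑ ≤ G (γ j t) * ‖deriv (γ j) t‖ₑ) :
    ‖∑ j, ∫ t in (0 : ℝ)..1, g j t‖ₑ ≤ ∫⁻ ζ, G ζ ∂(arcLengthMeasure γ) := by
  rw [lintegral_arcLengthMeasure hγ hG]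
  refine (enorm_sum_le _ _).trans (Finset.sum_le_sum fun j _ => ?_)
  rw [intervalIntegral.integral_of_le zero_le_one, ← integral_Ico_eq_integral_Ioc]
  exact (enorm_integral_le_lintegral_enorm _).trans (lintegral_mono fun t => hg j t)

variable {α : ℝ} {D : Set ℂ} {N : ℕ} {γ : Fin N → ℝ → ℂ} {f : ℂ → ℂ}

lemma IsC1HolderBoundary.mem_frontier (h : IsC1HolderBoundary α D γ) (j : Fin N) (t : ℝ) :
    γ j t ∈ frontier D := by
  rw [h.frontier_eq]
  exact mem_iUnion.2 ⟨j, mem_range_self t⟩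

lemma IsC1HolderBoundary.infDist_le_norm_sub (h : IsC1HolderBoundary α D γ) (hD : IsOpen D)
    (z : ℂ) (j : Fin N) (t : ℝ) : Metric.infDist z Dᶜ ≤ ‖γ j t - z‖ := by
  have h1 := h.mem_frontier j t
  rw [hD.frontier_eq] at h1
  rw [← dist_eq_norm, dist_comm]
  exact Metric.infDist_le_dist_of_mem h1.2

/-- The derivative of the Cauchy integral; the constant `f z` may be subtracted because
`dζ / (ζ - z)²` has a primitive along the closed boundary curves. -/
lemma IsC1HolderBoundary.hasDerivAt_cauchyS (h : IsC1HolderBoundary α D γ) (hD : IsOpen D)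
    (hc : ContinuousOn (extendFrom D f) (frontier D)) {z : ℂ} (hz : z ∈ D) (c : ℂ) :
    HasDerivAt (cauchyS D γ f) ((2 * (Real.pi : ℂ) * Complex.I)⁻¹ *
      ∑ j, ∫ t in (0 : ℝ)..1, (extendFrom D f (γ j t) - c) * deriv (γ j) t / (γ j t - z) ^ 2) z := by
  have hzj : ∀ j, z ∉ γ j '' uIcc 0 1 := fun j hj =>
    disjoint_left.1 (h.disjoint_range hD j) hz (image_subset_range _ _ hj)
  have hcj : ∀ j, Continuous fun t => extendFrom D f (γ j t) := fun j =>
    hc.comp_continuous (h.contDiff j).continuous (h.mem_frontier j)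
  have hdj : ∀ j, Continuous (deriv (γ j)) := fun j => (h.contDiff j).continuous_deriv le_rfl
  have hne : ∀ j, ∀ t ∈ uIcc (0 : ℝ) 1, (γ j t - z) ^ 2 ≠ 0 := fun j t ht h0 =>
    hzj j ⟨t, ht, sub_eq_zero.1 (pow_eq_zero_iff two_ne_zero |>.1 h0)⟩
  have hj : ∀ j, HasDerivAt
      (fun z => ∫ t in (0 : ℝ)..1, extendFrom D f (γ j t) / (γ j t - z) * deriv (γ j) t)
      (∫ t in (0 : ℝ)..1, (extendFrom D f (γ j t) - c) * deriv (γ j) t / (γ j t - z) ^ 2) z := by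
    intro j
    have h1 := hasDerivAt_cauchyTypeIntegral (a := 0) (b := 1)
      (φ := fun t => extendFrom D f (γ j t) * deriv (γ j) t) ((hcj j).mul (hdj j)).continuousOn
      (h.contDiff j).continuous.continuousOn (hzj j)
    have h2 : ∫ t in (0 : ℝ)..1, c * (deriv (γ j) t / (γ j t - z) ^ 2) = 0 := by
      rw [intervalIntegral.integral_const_mul, integral_deriv_div_sq (h.contDiff j) (hzj j)]
      have := h.periodic j 0
      rw [zero_add] at this
      rw [this, sub_self, mul_zero]
    have h3 : (∫ t in (0 : ℝ)..1, (extendFrom D f (γ j t) - c) * deriv (γ j) t / (γ j t - z) ^ 2) =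
        ∫ t in (0 : ℝ)..1, extendFrom D f (γ j t) * deriv (γ j) t / (γ j t - z) ^ 2 := by
      have hcp : ContinuousOn (fun t => (γ j t - z) ^ 2) (uIcc 0 1) :=
        (((h.contDiff j).continuous.sub continuous_const).pow 2).continuousOn
      rw [← sub_zero (∫ t in (0 : ℝ)..1, extendFrom D f (γ j t) * deriv (γ j) t / (γ j t - z) ^ 2),
        ← h2, ← intervalIntegral.integral_sub]
      · congr 1
        funext t
        ring
      · exact (((hcj j).mul (hdj j)).continuousOn.div hcp (hne j)).intervalIntegrable
      · exact (continuousOn_const.mul ((hdj j).continuousOn.div hcp (hne j))).intervalIntegrable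
    rw [h3]
    simpa only [div_mul_eq_mul_div] using h1
  exact (HasDerivAt.fun_sum fun j _ => hj j).const_mul _

/-- Gradient estimate for the Cauchy integral, from a power majorant of the modulus of
continuity `Ω` on `[δ, ∞)`. -/
lemma IsC1HolderBoundary.norm_deriv_cauchyS_le (h : IsC1HolderBoundary α D γ) (hD : IsOpen D)
    {A R : ℝ} (hA : 0 ≤ A) (hR : ∀ x ∈ closure D, ∀ y ∈ closure D, dist x y ≤ R) {z : ℂ}
    (hμ : ∀ r : ℝ, 0 < r → arcLengthMeasure γ (Metric.ball z r) ≤ ENNReal.ofReal (A * r))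
    (hz : z ∈ D) {Ω : ℝ → ℝ} {B Q κ S δ : ℝ} {k : ℕ} (hB : 0 ≤ B)
    (hf : ∀ ζ ∈ frontier D, ‖extendFrom D f ζ - f z‖ ≤ B * Ω ‖ζ - z‖)
    (hδ : 0 < δ) (hδz : δ ≤ Metric.infDist z Dᶜ)
    (hQ : 0 ≤ Q) (hκ : 0 ≤ κ) (hΩQ : ∀ ρ, δ ≤ ρ → Ω ρ ≤ Q * ρ ^ (1 - κ))
    (hk : R < 2 ^ k * δ) (hS : ∑ i ∈ Finset.range k, 2 * A * (2 ^ i * δ) ^ (-κ) ≤ S) :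
    ‖(2 * (Real.pi : ℂ) * Complex.I)⁻¹ * ∑ j, ∫ t in (0 : ℝ)..1,
      (extendFrom D f (γ j t) - f z) * deriv (γ j) t / (γ j t - z) ^ 2‖ ≤ B * (Q * S) := by
  set U : Set ℂ := Metric.ball z (2 ^ k * δ) \ Metric.ball z δ with hU
  have hUm : MeasurableSet U := Metric.isOpen_ball.measurableSet.diff Metric.isOpen_ball.measurableSet
  set G : ℂ → ℝ≥0∞ := U.indicator fun ζ => ENNReal.ofReal (B * Q) *
    ENNReal.ofReal (‖ζ - z‖ ^ (-1 - κ)) with hG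
  have hGm : Measurable G := Measurable.indicator (by fun_prop) hUm
  have hS0 : 0 ≤ S := (Finset.sum_nonneg fun i _ => by positivity).trans hS
  have h1 : ‖∑ j, ∫ t in (0 : ℝ)..1,
      (extendFrom D f (γ j t) - f z) * deriv (γ j) t / (γ j t - z) ^ 2‖ₑ ≤
      ENNReal.ofReal (B * Q * S) := by
    refine (enorm_sum_integral_le h.contDiff hGm fun j t => ?_).trans ?_
    · have hm := h.mem_frontier j t
      have hd := hδz.trans (h.infDist_le_norm_sub hD z j t)
      have hd0 : 0 < ‖γ j t - z‖ := hδ.trans_le hd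
      have hmU : γ j t ∈ U := by
        constructor
        · exact (hR _ (frontier_subset_closure hm) _ (subset_closure hz)).trans_lt hk
        · rwa [Metric.mem_ball, not_lt, dist_eq_norm]
      rw [hG, indicator_of_mem hmU, ← ENNReal.ofReal_mul (by positivity), ← ofReal_norm,
        ← ofReal_norm (deriv (γ j) t), ← ENNReal.ofReal_mul (by positivity)]
      refine ENNReal.ofReal_le_ofReal ?_
      rw [norm_div, norm_mul, norm_pow]
      have h2 : ‖extendFrom D f (γ j t) - f z‖ ≤ B * (Q * ‖γ j t - z‖ ^ (1 - κ)) :=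
        (hf _ hm).trans (by gcongr; exact hΩQ _ hd)
      have h3 : ‖γ j t - z‖ ^ (-1 - κ) = ‖γ j t - z‖ ^ (1 - κ) / ‖γ j t - z‖ ^ 2 := by
        rw [← Real.rpow_natCast, ← Real.rpow_sub hd0]
        congr 1
        push_cast
        ring
      calc _ ≤ B * (Q * ‖γ j t - z‖ ^ (1 - κ)) * ‖deriv (γ j) t‖ / ‖γ j t - z‖ ^ 2 := by gcongr
        _ = _ := by rw [h3]; ring
    · rw [hG, lintegral_indicator hUm, lintegral_const_mul _ (by fun_prop),
        ENNReal.ofReal_mul (p := B * Q) (by positivity)]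
      gcongr
      exact (lintegral_annulus_rpow_le z hμ hδ hκ hA k).trans (ENNReal.ofReal_le_ofReal hS)
  rw [← ofReal_norm, ENNReal.ofReal_le_ofReal_iff (by positivity)] at h1
  have h2 := norm_two_pi_I_inv_le_one
  rw [norm_mul]
  calc _ ≤ 1 * (B * Q * S) := by gcongr
    _ = _ := by ring

lemma IsC1HolderBoundary.norm_cauchyS_le (h : IsC1HolderBoundary α D γ) (hD : IsOpen D)
    {A R : ℝ} (hA : 0 ≤ A) (hR0 : 0 < R) (hR : ∀ x ∈ closure D, ∀ y ∈ closure D, dist x y < R)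
    {z : ℂ} (hμ : arcLengthMeasure γ (Metric.ball z R) ≤ ENNReal.ofReal (A * R))
    (hz : z ∈ D) {B δ : ℝ} (hB : 0 ≤ B) (hf : ∀ ζ ∈ frontier D, ‖extendFrom D f ζ‖ ≤ B)
    (hδ : 0 < δ) (hδz : δ ≤ Metric.infDist z Dᶜ) :
    ‖cauchyS D γ f z‖ ≤ B / δ * (A * R) := by
  set G : ℂ → ℝ≥0∞ := (Metric.ball z R).indicator fun _ => ENNReal.ofReal (B / δ) with hG
  have hGm : Measurable G := Measurable.indicator (by fun_prop) Metric.isOpen_ball.measurableSet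
  have h1 : ‖∑ j, ∫ t in (0 : ℝ)..1,
      extendFrom D f (γ j t) / (γ j t - z) * deriv (γ j) t‖ₑ ≤
      ENNReal.ofReal (B / δ * (A * R)) := by
    refine (enorm_sum_integral_le h.contDiff hGm fun j t => ?_).trans ?_
    · have hm := h.mem_frontier j t
      have hd := hδz.trans (h.infDist_le_norm_sub hD z j t)
      have hmU : γ j t ∈ Metric.ball z R :=
        hR _ (frontier_subset_closure hm) _ (subset_closure hz)
      rw [hG, indicator_of_mem hmU, enorm_mul]
      gcongr
      rw [← ofReal_norm, norm_div]
      refine ENNReal.ofReal_le_ofReal ?_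
      gcongr
      exact hf _ hm
    · rw [hG, lintegral_indicator Metric.isOpen_ball.measurableSet, setLIntegral_const,
        ENNReal.ofReal_mul (by positivity)]
      gcongr
  rw [← ofReal_norm, ENNReal.ofReal_le_ofReal_iff (by positivity)] at h1
  have h2 := norm_two_pi_I_inv_le_one
  rw [cauchyS, norm_mul]
  calc _ ≤ 1 * (B / δ * (A * R)) := by gcongr
    _ = _ := by ring

end CauchyIntegral

/-! ### Log-Hölder norms in terms of the gauge -/

section LogHolder

open Set Filter

variable {D : Set ℂ} {α ν : ℝ} {f : ℂ → ℂ}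

lemma MemLogHolder.norm_le (h : MemLogHolder α ν D f) {z : ℂ} (hz : z ∈ D) :
    ‖f z‖ ≤ (logHolderNorm α ν D f).toReal := by
  rw [← ENNReal.ofReal_le_iff_le_toReal h.2.ne]
  exact le_add_right (le_iSup₂_of_le z hz le_rfl)

lemma MemLogHolder.norm_sub_le (h : MemLogHolder α ν D f) {z w : ℂ} (hz : z ∈ D) (hw : w ∈ D)
    (h0 : 0 < ‖w - z‖) (h1 : ‖w - z‖ ≤ 1 / 2) :
    ‖f w - f z‖ ≤ (logHolderNorm α ν D f).toReal * (‖w - z‖ ^ α * |Real.log ‖w - z‖| ^ ν) := by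
  have hl := (abs_log_comparable h0 h1).1
  rw [← div_le_iff₀ (by positivity), ← ENNReal.ofReal_le_iff_le_toReal h.2.ne]
  exact le_add_left (le_iSup₂_of_le z hz (le_iSup₂_of_le w hw (le_iSup_of_le ⟨h0, h1⟩ le_rfl)))

/-- For `r ≥ 1/2` the gauge is bounded below. -/
lemma exists_pos_le_logGauge (α ν : ℝ) (hα : 0 < α) :
    ∃ c : ℝ, 0 < c ∧ ∀ r, 1 / 2 ≤ r → c ≤ logGauge α ν r := by
  obtain ⟨K, hK, h⟩ := exists_logGauge_le_mul ν hα
  have h0 := logGauge_pos α ν (r := 1 / 2) (by norm_num)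
  refine ⟨logGauge α ν (1 / 2) / K, by positivity, fun r hr => ?_⟩
  have h1 := h (1 / 2) (2 * r) (by norm_num) (by linarith)
  rw [neg_zero, Real.rpow_zero, mul_one, show 2 * r * (1 / 2) = r by ring] at h1
  rw [div_le_iff₀ hK]
  linarith

/-- The Log-Hölder norm controls the modulus of continuity at all distances in terms of
`logGauge`. -/
lemma exists_norm_sub_le_logGauge (D : Set ℂ) (α ν : ℝ) (hα : 0 < α) :
    ∃ C : ℝ, 1 ≤ C ∧ ∀ f, MemLogHolder α ν D f → ∀ z ∈ D, ∀ w ∈ D, 0 < ‖w - z‖ →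
      ‖f w - f z‖ ≤ C * (logHolderNorm α ν D f).toReal * logGauge α ν ‖w - z‖ := by
  obtain ⟨c, hc, hcr⟩ := exists_pos_le_logGauge α ν hα
  have h3 : (1 : ℝ) ≤ 3 ^ |ν| := Real.one_le_rpow (by norm_num) (abs_nonneg ν)
  refine ⟨3 ^ |ν| + 2 / c, by linarith [div_pos two_pos hc], fun f h z hz w hw h0 => ?_⟩
  have hM := ENNReal.toReal_nonneg (a := logHolderNorm α ν D f)
  have hg := logGauge_pos α ν h0
  rcases le_or_gt ‖w - z‖ (1 / 2) with h1 | h1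
  · refine (h.norm_sub_le hz hw h0 h1).trans ?_
    calc _ ≤ (logHolderNorm α ν D f).toReal * (3 ^ |ν| * logGauge α ν ‖w - z‖) := by
          exact mul_le_mul_of_nonneg_left (rpow_mul_abs_log_le_logGauge α ν h0 h1) hM
      _ = 3 ^ |ν| * (logHolderNorm α ν D f).toReal * logGauge α ν ‖w - z‖ := by ring
      _ ≤ _ := by
          gcongr
          linarith [div_pos two_pos hc]
  · have h2 : ‖f w - f z‖ ≤ 2 * (logHolderNorm α ν D f).toReal := by
      linarith [_root_.norm_sub_le (f w) (f z), h.norm_le hz, h.norm_le hw]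
    calc _ ≤ _ := h2
      _ = 2 / c * (logHolderNorm α ν D f).toReal * c := by field_simp
      _ ≤ (3 ^ |ν| + 2 / c) * (logHolderNorm α ν D f).toReal * logGauge α ν ‖w - z‖ := by
          gcongr
          · linarith
          · exact hcr _ h1.le

lemma logHolderNorm_le {B : ℝ} (hB : 0 ≤ B) (h1 : ∀ z ∈ D, ‖f z‖ ≤ B)
    (h2 : ∀ z ∈ D, ∀ w ∈ D, 0 < ‖w - z‖ → ‖f w - f z‖ ≤ B * logGauge α ν ‖w - z‖) :
    logHolderNorm α ν D f ≤ ENNReal.ofReal ((1 + 3 ^ |ν|) * B) := by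
  rw [one_add_mul, ENNReal.ofReal_add hB (by positivity)]
  refine add_le_add (iSup₂_le fun z hz => ENNReal.ofReal_le_ofReal (h1 z hz))
    (iSup₂_le fun z hz => iSup₂_le fun w hw => iSup_le fun h => ENNReal.ofReal_le_ofReal ?_)
  have hl := (abs_log_comparable h.1 h.2).1
  have h0 := h.1
  rw [div_le_iff₀ (by positivity)]
  calc _ ≤ _ := h2 z hz w hw h.1
    _ ≤ B * (3 ^ |ν| * (‖w - z‖ ^ α * |Real.log ‖w - z‖| ^ ν)) := by
      gcongr
      exact logGauge_le_rpow_mul_abs_log α ν h.1 h.2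
    _ = _ := by ring

end LogHolder

/-! ### Boundedness of the Cauchy integral -/

section MainEstimate

open Set Filter

/-- The integral of `logGauge α ν ρ / ρ²` over `δ ≤ ρ ≤ R` against a measure with
`μ (B(z, ρ)) ≤ A ρ` is at most a multiple of `logGauge α ν' δ / δ`. This is encoded by a power
majorant `Q ρ ^ (1 - κ)` of the gauge on `[δ, ∞)` and a bound `S` for the sum over the dyadic
annuli `2 ^ i δ ≤ ρ < 2 ^ (i + 1) δ`, `i < k`, which exhaust `ρ ≤ R`. -/
def DyadicSumBound (α ν ν' : ℝ) : Prop :=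
  ∀ A R : ℝ, 0 < A → 0 < R → ∃ C : ℝ, 0 < C ∧ ∀ δ : ℝ, 0 < δ → ∃ (Q κ S : ℝ) (k : ℕ),
    0 ≤ Q ∧ 0 ≤ κ ∧ (∀ ρ, δ ≤ ρ → logGauge α ν ρ ≤ Q * ρ ^ (1 - κ)) ∧ R < 2 ^ k * δ ∧
    ∑ i ∈ Finset.range k, 2 * A * (2 ^ i * δ) ^ (-κ) ≤ S ∧ Q * S ≤ C * (logGauge α ν' δ / δ)

/-- For `α < 1` a majorant with `κ = (1 - α) / 2` absorbs the logarithm and leaves a geometric series. -/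
lemma dyadicSumBound_of_lt_one {α : ℝ} (hα : α < 1) (ν : ℝ) : DyadicSumBound α ν ν := by
  intro A R hA hR
  obtain ⟨K, hK, h⟩ := exists_logGauge_mul_le ν (show α < (1 + α) / 2 by linarith)
  set κ : ℝ := (1 - α) / 2 with hκ
  have hκ0 : 0 < κ := by rw [hκ]; linarith
  have hb : (1 + α) / 2 = 1 - κ := by rw [hκ]; ring
  rw [hb] at h
  have hq0 : (0 : ℝ) < 2 ^ (-κ) := by positivity
  have hq1 : (2 : ℝ) ^ (-κ) < 1 := Real.rpow_lt_one_of_one_lt_of_neg one_lt_two (by linarith)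
  have hq2 := sub_pos.2 hq1
  refine ⟨2 * A * K * (1 - 2 ^ (-κ))⁻¹, by positivity, fun δ hδ => ?_⟩
  obtain ⟨k, hk⟩ := pow_unbounded_of_one_lt (R / δ) (one_lt_two (α := ℝ))
  have hg := logGauge_pos α ν hδ
  refine ⟨K * δ ^ (-(1 - κ)) * logGauge α ν δ, κ, 2 * A * δ ^ (-κ) * (1 - 2 ^ (-κ))⁻¹, k,
    by positivity, hκ0.le, fun ρ hρ => ?_, by rwa [div_lt_iff₀ hδ] at hk, ?_, le_of_eq ?_⟩
  · have hρ0 := hδ.trans_le hρ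
    have h1 := h δ (ρ / δ) hδ ((one_le_div hδ).2 hρ)
    rw [div_mul_cancel₀ _ hδ.ne', Real.div_rpow hρ0.le hδ.le] at h1
    rw [Real.rpow_neg hδ.le]
    calc _ ≤ _ := h1
      _ = _ := by ring
  · calc ∑ i ∈ Finset.range k, 2 * A * (2 ^ i * δ) ^ (-κ)
        = 2 * A * δ ^ (-κ) * ∑ i ∈ Finset.range k, ((2 : ℝ) ^ (-κ)) ^ i := by
          rw [Finset.mul_sum]
          refine Finset.sum_congr rfl fun i _ => ?_
          rw [Real.mul_rpow (by positivity) hδ.le, ← Real.rpow_natCast, ← Real.rpow_mul (by norm_num),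
            mul_comm (i : ℝ), Real.rpow_mul (by norm_num), Real.rpow_natCast]
          ring
      _ ≤ _ := by
          gcongr
          rw [← tsum_geometric_of_lt_one hq0.le hq1]
          exact (summable_geometric_of_lt_one hq0.le hq1).sum_le_tsum _ fun i _ => by positivity
  · have h2 : δ ^ (-(1 - κ)) * δ ^ (-κ) = δ⁻¹ := by
      rw [← Real.rpow_add hδ, ← Real.rpow_neg_one]
      congr 1
      ring
    rw [div_eq_mul_inv _ δ, ← h2]
    ring

lemma logGauge_mul_one_add (α ν r : ℝ) :
    logGauge α ν r * (1 + max 0 (-Real.log r)) = logGauge α (ν + 1) r := by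
  have := one_le_one_add_max_neg_log r
  unfold logGauge
  rw [mul_assoc, Real.rpow_add_one (by linarith)]

/-- At the exponent `1` every dyadic annulus contributes equally; their number costs one power of
the logarithm. -/
lemma dyadicSumBound_one {ν : ℝ} (hν : 0 ≤ ν) : DyadicSumBound 1 ν (ν + 1) := by
  intro A R hA hR
  have hl2 := Real.log_pos one_lt_two
  set c : ℝ := (|Real.log R| + 1) / Real.log 2 + 1 with hc
  have hc0 : 0 < c := by positivity
  refine ⟨2 * A * c, by positivity, fun δ hδ => ?_⟩
  have hg := logGauge_pos 1 ν hδ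
  -- the number of dyadic annuli needed to go from `δ` to `R`
  set k : ℕ := ⌊Real.log (R / δ) / Real.log 2⌋₊ + 1 with hk
  have hkl : Real.log (R / δ) / Real.log 2 < k := by
    rw [hk]
    push_cast
    exact Nat.lt_floor_add_one _
  have hℓ := one_le_one_add_max_neg_log δ
  have hkc : (k : ℝ) ≤ c * (1 + max 0 (-Real.log δ)) := by
    have h1 : (⌊Real.log (R / δ) / Real.log 2⌋₊ : ℝ) ≤
        (|Real.log R| + max 0 (-Real.log δ)) / Real.log 2 := by
      rcases le_total 0 (Real.log (R / δ) / Real.log 2) with h0 | h0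
      · refine (Nat.floor_le h0).trans ?_
        rw [Real.log_div hR.ne' hδ.ne']
        gcongr
        linarith [le_abs_self (Real.log R), le_max_right 0 (-Real.log δ)]
      · rw [Nat.floor_of_nonpos h0]
        have := le_max_left 0 (-Real.log δ)
        push_cast
        positivity
    rw [hk, hc]
    push_cast
    have h2 : (|Real.log R| + max 0 (-Real.log δ)) / Real.log 2 ≤
        (|Real.log R| + 1) / Real.log 2 * (1 + max 0 (-Real.log δ)) := by
      rw [div_mul_eq_mul_div]
      gcongr
      nlinarith [mul_nonneg (abs_nonneg (Real.log R)) (sub_nonneg.2 hℓ)]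
    nlinarith
  refine ⟨logGauge 1 ν δ / δ, 0, 2 * A * k, k, by positivity, le_rfl, fun ρ hρ => ?_, ?_, ?_, ?_⟩
  · have h1 := logGauge_one_mul_le hν hδ ((one_le_div hδ).2 hρ)
    rw [div_mul_cancel₀ _ hδ.ne'] at h1
    rw [sub_zero, Real.rpow_one]
    calc _ ≤ _ := h1
      _ = _ := by ring
  · rw [div_lt_iff₀ hl2, ← Real.log_pow, Real.log_lt_log_iff (by positivity) (by positivity),
      div_lt_iff₀ hδ] at hkl
    exact hkl
  · simp [mul_comm]
  · rw [← logGauge_mul_one_add]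
    calc _ ≤ logGauge 1 ν δ / δ * (2 * A * (c * (1 + max 0 (-Real.log δ)))) := by gcongr
      _ = _ := by ring

lemma isGrowthGauge_logGauge_of_lt_one {α : ℝ} (hα : 0 < α) (hα1 : α < 1) (ν : ℝ) :
    ∃ K a, IsGrowthGauge (logGauge α ν) K a := by
  obtain ⟨K₁, hK₁, h₁⟩ := exists_logGauge_mul_le ν hα1
  obtain ⟨K₂, hK₂, h₂⟩ := exists_logGauge_le_mul ν (half_lt_self hα)
  refine ⟨1 + K₁ + K₂, α / 2, by linarith, by linarith, fun r => logGauge_pos α ν,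
    fun r l hr hl => (h₁ r l hr hl).trans ?_, fun r l hr hl => (h₂ r l hr hl).trans ?_⟩
  · have := logGauge_pos α ν hr
    rw [Real.rpow_one]
    gcongr
    linarith
  · have := logGauge_pos α ν (mul_pos (one_pos.trans_le hl) hr)
    have : 0 < l := by linarith
    gcongr
    linarith

lemma isGrowthGauge_logGauge_one {ν : ℝ} (hν : 0 ≤ ν) :
    ∃ K a, IsGrowthGauge (logGauge 1 ν) K a := by
  obtain ⟨K₂, hK₂, h₂⟩ := exists_logGauge_le_mul ν (half_lt_self (zero_lt_one' ℝ))
  refine ⟨1 + K₂, 1 / 2, by linarith, by norm_num, fun r => logGauge_pos 1 ν,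
    fun r l hr hl => (logGauge_one_mul_le hν hr hl).trans ?_,
    fun r l hr hl => (h₂ r l hr hl).trans ?_⟩
  · have := logGauge_pos 1 ν hr
    gcongr
    nlinarith
  · have := logGauge_pos 1 ν (mul_pos (one_pos.trans_le hl) hr)
    have : 0 < l := by linarith
    gcongr
    linarith

/-- Boundedness of the Cauchy integral from `C^{L^α Log^ν L}` to `C^{L^α Log^ν' L}`, given the
one-dimensional sum estimate. All constants come from one parametrization `γ₀`, so that they depend
on `D` only. -/
theorem exists_logHolderNorm_cauchyS_le {D : Set ℂ} (hD : IsOpen D) (hDc : IsConnected D)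
    (hDb : Bornology.IsBounded D) {α β ν ν' : ℝ} (hα : 0 < α)
    (hgauge : ∃ K a, IsGrowthGauge (logGauge α ν') K a) (hsum : DyadicSumBound α ν ν') :
    ∃ C : ℝ≥0, ∀ (N : ℕ) (γ : Fin N → ℝ → ℂ), IsC1HolderBoundary β D γ →
      ∀ f : ℂ → ℂ, MemLogHolder α ν D f →
        MemLogHolder α ν' D (cauchyS D γ f) ∧
          logHolderNorm α ν' D (cauchyS D γ f) ≤ C * logHolderNorm α ν D f := by
  by_cases hex : ∃ (N : ℕ) (γ : Fin N → ℝ → ℂ), IsC1HolderBoundary β D γ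
  swap
  · exact ⟨0, fun N γ h => absurd ⟨N, γ, h⟩ hex⟩
  obtain ⟨N₀, γ₀, h₀⟩ := hex
  obtain ⟨K, a, hΩ'⟩ := hgauge
  obtain ⟨A, hA, hμ⟩ := h₀.exists_arcLengthMeasure_ball_le (α := β)
  obtain ⟨r, hr, hcone⟩ := h₀.exists_uniformConeCondition hD hDc hDb
  have hne : (Dᶜ).Nonempty := nonempty_compl_of_isBounded hDb
  obtain ⟨R, hR, hRD⟩ : ∃ R : ℝ, 0 < R ∧ ∀ x ∈ closure D, ∀ y ∈ closure D, dist x y < R :=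
    ⟨Metric.diam (closure D) + 1, by positivity, fun x hx y hy =>
      (Metric.dist_le_diam_of_mem hDb.closure hx hy).trans_lt (lt_add_one _)⟩
  obtain ⟨C₁, hC₁, hmod⟩ := exists_modulus_of_gradientBound hΩ' hne hr hcone
  obtain ⟨C₂, hC₂, hdy⟩ := hsum A R hA hR
  obtain ⟨C₃, hC₃, hfC⟩ := exists_norm_sub_le_logGauge D α ν hα
  have hC₃0 : 0 < C₃ := by linarith
  set C₄ : ℝ := C₂ + (r / 2)⁻¹ * (A * R) with hC₄
  have hC₄0 : 0 < C₄ := by positivity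
  set C : ℝ := (1 + 3 ^ |ν'|) * (C₁ * (C₃ * C₄)) with hC
  have hC0 : 0 ≤ C := by positivity
  refine ⟨C.toNNReal, fun N γ h f hf => ?_⟩
  have hM0 := ENNReal.toReal_nonneg (a := logHolderNorm α ν D f)
  set B : ℝ := C₃ * (logHolderNorm α ν D f).toReal with hB
  have hB0 : 0 ≤ B := by positivity
  have hfB : ∀ z ∈ D, ‖f z‖ ≤ B := fun z hz => (hf.norm_le hz).trans (by rw [hB]; nlinarith)
  have hfm : ∀ z ∈ D, ∀ w ∈ D, 0 < ‖w - z‖ → ‖f w - f z‖ ≤ B * logGauge α ν ‖w - z‖ := hfC f hf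
  have hΩ0 := tendsto_logGauge_zero ν hα
  have hcont : ContinuousOn (extendFrom D f) (frontier D) :=
    continuousOn_extendFrom frontier_subset_closure fun ζ hζ =>
      exists_tendsto_of_modulus hΩ0 hfm (frontier_subset_closure hζ)
  have hpos : ∀ z ∈ D, 0 < Metric.infDist z Dᶜ := fun z hz =>
    (hD.isClosed_compl.notMem_iff_infDist_pos hne).1 fun h => h hz
  have hgrad : GradientBound D (logGauge α ν') (B * C₄) (cauchyS D γ f) := by
    intro z hz
    refine ⟨_, h.hasDerivAt_cauchyS hD hcont hz (f z), ?_⟩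
    have hδ := hpos z hz
    obtain ⟨Q, κ, S, k, hQ, hκ, hΩQ, hk, hS, hQS⟩ := hdy _ hδ
    refine (h.norm_deriv_cauchyS_le hD hA.le (fun x hx y hy => (hRD x hx y hy).le) (hμ N γ h z) hz
      hB0 (fun ζ hζ => ?_) hδ le_rfl hQ hκ hΩQ hk hS).trans ?_
    · refine norm_extendFrom_sub_le hΩ0 (fun r hr => continuousAt_logGauge α ν hr) hfm
        (frontier_subset_closure hζ) hz (norm_pos_iff.2 (sub_ne_zero.2 ?_))
      rintro rfl
      rw [hD.frontier_eq] at hζ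
      exact hζ.2 hz
    · have := logGauge_pos α ν' hδ
      rw [mul_assoc B]
      refine mul_le_mul_of_nonneg_left ?_ hB0
      refine hQS.trans ?_
      gcongr
      rw [hC₄]
      have : 0 < (r / 2)⁻¹ * (A * R) := by positivity
      linarith
  have hint : ∀ z ∈ D, r / 2 ≤ Metric.infDist z Dᶜ → ‖cauchyS D γ f z‖ ≤ B * C₄ := by
    intro z hz hzr
    refine (h.norm_cauchyS_le hD hA.le hR hRD (hμ N γ h z R hR) hz hB0 (fun ζ hζ =>
      norm_extendFrom_le hΩ0 hfm hfB (frontier_subset_closure hζ)) (half_pos hr) hzr).trans ?_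
    rw [div_eq_mul_inv, mul_assoc B, hC₄]
    gcongr
    linarith
  obtain ⟨hsup, hlip⟩ := hmod (cauchyS D γ f) (B * C₄) (by positivity) hgrad hint
  have hle : logHolderNorm α ν' D (cauchyS D γ f) ≤ C.toNNReal * logHolderNorm α ν D f := by
    refine (logHolderNorm_le (by positivity) hsup hlip).trans (le_of_eq ?_)
    rw [show (1 + 3 ^ |ν'|) * (C₁ * (B * C₄)) = C * (logHolderNorm α ν D f).toReal by
      rw [hC, hB]; ring, ENNReal.ofReal_mul hC0, ENNReal.ofReal_toReal hf.2.ne]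
    rfl
  refine ⟨⟨fun z hz => ?_, hle.trans_lt (ENNReal.mul_lt_top ENNReal.coe_lt_top hf.2)⟩, hle⟩
  obtain ⟨F', hF', -⟩ := hgrad z hz
  exact hF'.continuousAt.continuousWithinAt

end MainEstimate

theorem theorem4p5 (D : Set ℂ) (hD_open : IsOpen D) (hD_conn : IsConnected D)
    (hD_bdd : Bornology.IsBounded D) (α ν : ℝ) (hα : 0 < α) :
    (α < 1 →
      ∃ C : ℝ≥0, ∀ (N : ℕ) (γ : Fin N → ℝ → ℂ), IsC1HolderBoundary α D γ →
        ∀ f : ℂ → ℂ, MemLogHolder α ν D f →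
          MemLogHolder α ν D (cauchyS D γ f) ∧
            logHolderNorm α ν D (cauchyS D γ f) ≤ C * logHolderNorm α ν D f) ∧
    (α = 1 → 0 ≤ ν →
      ∃ C : ℝ≥0, ∀ (N : ℕ) (γ : Fin N → ℝ → ℂ), IsC1HolderBoundary 1 D γ →
        ∀ f : ℂ → ℂ, MemLogHolder 1 ν D f →
          MemLogHolder 1 (ν + 1) D (cauchyS D γ f) ∧
            logHolderNorm 1 (ν + 1) D (cauchyS D γ f) ≤ C * logHolderNorm 1 ν D f) :=
  ⟨fun hα1 => exists_logHolderNorm_cauchyS_le hD_open hD_conn hD_bdd hα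
      (isGrowthGauge_logGauge_of_lt_one hα hα1 ν) (dyadicSumBound_of_lt_one hα1 ν),
    fun _ hν => exists_logHolderNorm_cauchyS_le hD_open hD_conn hD_bdd one_pos
      (isGrowthGauge_logGauge_one (by linarith)) (dyadicSumBound_one hν)⟩
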